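/- **Setting.** For matrices, $|\cdot|$ denotes the Euclidean (Frobenius) norm; balls are open; $d(U)$ is the diameter of $U$; $\overline u_{x,r}$ is the mean of $u$ over $B_r(x)$; $(\nabla u)_{ij}=\partial_j u_i$; and $H^1(\Omega,S^2)$ is the set of $u\in H^1(\Omega,\mathbb R^3)$ with $|u|=1$ a.e. Let $L,\beta>0$, let $M,N,d\in\mathbb R$ and let $K:(0,1)\to(0,\infty)$. We say that $(\Omega,\mathbf A,u,\eta)$ satisfies (A1) with these data if $\Omega\subset\mathbb R^3$ is a bounded domain with $d(\Omega)\le d$, $\mathbf A:\Omega\to\mathbb R^{3\times 3}$, $\eta>0$, $u\in H^1(\Omega,S^2)$, and 1. $|\mathbf A(x)\mathbf A(x)^T-\mathbf A(y)\mathbf A(y)^T|\le L|x-y|$ for all $x,y\in\Omega$; 2. $\frac1\beta|\xi|^2\le \mathbf A(x)\mathbf A(x)^T\xi\cdot\xi\le\beta|\xi|^2$ for all $\xi\in\mathbb R^3$, $x\in\Omega$; 3. $|\mathbf A(x)^{-1}|\le M$ and $|\mathbf A(x)|\le N$ for all $x\in\Omega$; 4. for every $\alpha\in(0,1)$, every open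 $U\subset\subset\Omega$ and every $v\in H^1(\Omega,S^2)$ with $v=u$ a.e. on $\Omega\setminus U$, $$\int_U|\nabla u\,\mathbf A|^2\le\int_U|\nabla v\,\mathbf A|^2+K(\alpha)\,\eta^2\,d(U)^{1+2\alpha}.$$ **Theorem.** Fix $L,M,N,\beta,d,K$ as above and $c_0\in(0,1)$. Let $\alpha\in(0,1)$ and $\Lambda>0$. (a) (Reverse Poincaré inequality.) There is a constant $C>0$ depending only on $\alpha,\Lambda,L,M,N,\beta,d,K,c_0$ such that the following holds for all $(\Omega,\mathbf A,u,\eta)$ satisfying (A1) with the given data: if $r>0$, $B_{2r}(x_0)\subset\Omega$ and $\frac1r\int_{B_{2r}(x_0)}|\nabla u\,\mathbf A|^2\le\Lambda$, then $$\frac1r\int_{B_{c_0r/2}(x_0)}|\nabla u|^2\le C\Big(\frac1{r^3}\int_{B_r(x_0)}|u-\overline u_{x_0,r}|^2+\eta^2r^{2\alpha}\Big).$$ (b) (Uniform version.) There is a constant $C>0$ depending only on $\alpha,\Lambda,L,M,N,\beta,d,K,c_0$ such that the following holds for all $(\Omega,\mathbf A,u,\eta)$ satisfying (A1) with the given data: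 if $r>0$, $B_{3r}(x_0)\subset\Omega$ and $\frac1r\int_{B_{3r}(x_0)}|\nabla u\,\mathbf A|^2\le\Lambda$, then $$\frac1s\int_{B_{c_0s/2}(y)}|\nabla u|^2\le C\Big(\frac1{s^3}\int_{B_s(y)}|u-\overline u_{y,s}|^2+\eta^2s^{2\alpha}\Big)$$ for all $y\in B_r(x_0)$ and all $0<s\le c_0r$. -/

import Mathlib

open MeasureTheory Set
open scoped ContDiff

namespace ReversePoincare

/-- Euclidean three-space. -/
abbrev E3 : Type := EuclideanSpace ℝ (Fin 3)

/-- Real `3 × 3` matrices. -/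
abbrev Mat3 : Type := Matrix (Fin 3) (Fin 3) ℝ

/-- The square `|B|² = B : B` of the Euclidean (Frobenius) norm of a matrix. -/
def normSq (B : Mat3) : ℝ := ∑ i, ∑ j, B i j ^ 2

/-- The Euclidean (Frobenius) norm `|B|` of a matrix. -/
noncomputable def matNorm (B : Mat3) : ℝ := Real.sqrt (normSq B)

/-- `Du` is a weak gradient of `u` on `Ω`, with the convention `(∇u)_{ij} = ∂_j u_i`:
`∫_Ω u_i ∂_j φ = - ∫_Ω (Du)_{ij} φ` for all `φ ∈ C_c^∞(Ω)`.
Only the values of `u` and `Du` on `Ω` matter. -/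
def HasWeakGradient (Ω : Set E3) (u : E3 → E3) (Du : E3 → Mat3) : Prop :=
  ∀ φ : E3 → ℝ, ContDiff ℝ ∞ φ → HasCompactSupport φ → tsupport φ ⊆ Ω →
    ∀ i j : Fin 3,
      ∫ x in Ω, u x i * fderiv ℝ φ x (EuclideanSpace.single j 1)
        = - ∫ x in Ω, Du x i j * φ x

/-- `u ∈ H¹(Ω, S²)` with weak gradient `∇u = Du`. -/
structure IsH1Sphere (Ω : Set E3) (u : E3 → E3) (Du : E3 → Mat3) : Prop where
  memLp : MemLp u 2 (volume.restrict Ω)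
  grad_memLp : ∀ i j : Fin 3, MemLp (fun x => Du x i j) 2 (volume.restrict Ω)
  hasWeakGradient : HasWeakGradient Ω u Du
  mem_sphere : ∀ᵐ x ∂(volume.restrict Ω), ‖u x‖ = 1

/-- Assumption (A1) on the domain `Ω`, the coefficient field `A : Ω → ℝ^{3×3}` and the map
`u ∈ H¹(Ω, S²)` with weak gradient `∇u = Du`. The numbers `L`, `M`, `N`, `β` are the bounds
for `A`; `η` and the function `α ↦ K α` are those of the almost-minimality inequality. -/
structure A1 (Ω : Set E3) (A : E3 → Mat3) (u : E3 → E3) (Du : E3 → Mat3)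
    (L M N β η : ℝ) (K : ℝ → ℝ) : Prop where
  isOpen : IsOpen Ω
  isConnected : IsConnected Ω
  isBounded : Bornology.IsBounded Ω
  L_pos : 0 < L
  lipschitz : ∀ x ∈ Ω, ∀ y ∈ Ω,
    matNorm (A x * (A x).transpose - A y * (A y).transpose) ≤ L * dist x y
  β_pos : 0 < β
  elliptic : ∀ x ∈ Ω, ∀ ξ : Fin 3 → ℝ,
    1 / β * (ξ ⬝ᵥ ξ) ≤ ((A x * (A x).transpose).mulVec ξ) ⬝ᵥ ξ ∧
      ((A x * (A x).transpose).mulVec ξ) ⬝ᵥ ξ ≤ β * (ξ ⬝ᵥ ξ)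
  inv_bound : ∀ x ∈ Ω, matNorm (A x)⁻¹ ≤ M
  bound : ∀ x ∈ Ω, matNorm (A x) ≤ N
  isH1Sphere : IsH1Sphere Ω u Du
  η_pos : 0 < η
  K_pos : ∀ α ∈ Ioo (0 : ℝ) 1, 0 < K α
  /-- Almost-minimality; `U ⊂⊂ Ω` for the open set `U` means here `closure U ⊆ Ω`, because
  `Ω` is bounded. -/
  almost_minimizer : ∀ α ∈ Ioo (0 : ℝ) 1, ∀ U : Set E3, IsOpen U → closure U ⊆ Ω →
    ∀ (v : E3 → E3) (Dv : E3 → Mat3), IsH1Sphere Ω v Dv →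
      (∀ᵐ x ∂(volume.restrict (Ω \ U)), v x = u x) →
      ∫ x in U, normSq (Du x * A x)
        ≤ (∫ x in U, normSq (Dv x * A x)) + K α * η ^ 2 * Metric.diam U ^ (1 + 2 * α)

/-- The reverse Poincaré inequality with exponent `α` and constant `C` on the ball `B_r(x)`,
with the gradient on the smaller ball `B_{c₀ r / 2}(x)`. -/
def ReversePoincareOn (u : E3 → E3) (Du : E3 → Mat3) (c₀ η α C : ℝ) (x : E3) (r : ℝ) : Prop :=
  1 / r * ∫ z in Metric.ball x (c₀ * r / 2), normSq (Du z)
    ≤ C * (1 / r ^ 3 * (∫ z in Metric.ball x r, ‖u z - ⨍ w in Metric.ball x r, u w‖ ^ 2)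
        + η ^ 2 * r ^ (2 * α))

end ReversePoincare

/-! Write f(s) for the integral of |∇u|² over B_s(x₀). The core is a hole-filling estimate
(`exists_hole_filling`): for ρ < R with the closed ball of radius R inside Ω, and any constant ξ,
f(R) is at most P times [f(R) - f(ρ) + (R-ρ)⁻² ∫_{B_R} |u-ξ|²], plus an error of order η² R^(1+2α).
Since f(ρ) ≤ f(R), this turns into f(ρ) ≤ P/(1+P) f(R) + ..., and the iteration lemma
`exists_iteration_const` absorbs f(R) because P/(1+P) < 1. Taking ξ to be the mean of u gives the
reverse Poincaré inequality on every ball contained in Ω, with a constant depending only on α, β,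
K(α) and c₀. Both parts of the theorem are instances.

Hole filling compares u with a sphere-valued map v that equals u outside B_R and whose energy in B_R
is controlled by the annulus B_R \ B_ρ and by u-ξ (`exists_competitor`). A cutoff θ gives w = (1-θ)u
+ θξ, which is constant in B_ρ but leaves the sphere (`exists_interpolation`). Projecting w radially
onto the sphere from a centre a with |a| < 1/2 repairs this and fixes every point already on the
sphere (`exists_projection`). The projection has derivative of order |w-a|⁻¹. In dimension three
|y-a|⁻² is integrable in a over a ball, uniformly in y, so by Fubini some a makes the energy of v at
most a constant times that of w (`exists_center`).

The projection is singular at a. Its weak chain rule follows from a C¹ chain rule, proved by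
mollification, applied to projections regularized at scale ε → 0. -/

namespace ReversePoincare

open Filter Metric
open scoped Topology Convolution

/-! ### Weak directional derivatives: mollification, chain rule, product rule -/

section WeakDerivative

set_option linter.unusedSectionVars false

variable {E F F' : Type*} [NormedAddCommGroup E] [NormedSpace ℝ E] [FiniteDimensional ℝ E]
  [MeasurableSpace E] [BorelSpace E] [NormedAddCommGroup F] [NormedSpace ℝ F]
  [NormedAddCommGroup F'] [NormedSpace ℝ F'] {μ : Measure E}

/-- A sequence of bump functions shrinking to the origin. -/
noncomputable def mollifier (n : ℕ) : ContDiffBump (0 : E) where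
  -- The fixed ratio `rOut = 2 * rIn` is what almost everywhere convergence of the mollifications
  -- requires.
  rIn := 1 / ((n : ℝ) + 1) / 2
  rOut := 1 / ((n : ℝ) + 1)
  rIn_pos := by positivity
  rIn_lt_rOut := half_lt_self (by positivity)

lemma tendsto_mollifier_rOut :
    Tendsto (fun n => (mollifier (E := E) n).rOut) atTop (𝓝 0) :=
  tendsto_one_div_add_atTop_nhds_zero_nat

/-- Mollification of `g` at scale `1 / (n + 1)`. -/
noncomputable def mollify (μ : Measure E) (n : ℕ) (g : E → F) : E → F :=
  (mollifier n).normed μ ⋆[ContinuousLinearMap.lsmul ℝ ℝ, μ] g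

variable [μ.IsAddHaarMeasure]

lemma integrable_mollify {g : E → F} (hg : Integrable g μ) (n : ℕ) :
    Integrable (mollify μ n g) μ :=
  ((mollifier n).integrable_normed (μ := μ)).integrable_convolution _ hg

lemma contDiff_mollify [CompleteSpace F] {g : E → F} (hg : Integrable g μ) (n : ℕ) :
    ContDiff ℝ ∞ (mollify μ n g) :=
  (mollifier n).hasCompactSupport_normed.contDiff_convolution_left _
    (mollifier n).contDiff_normed hg.locallyIntegrable

lemma ae_tendsto_mollify [CompleteSpace F] {g : E → F} (hg : Integrable g μ) :
    ∀ᵐ x ∂μ, Tendsto (fun n => mollify μ n g x) atTop (𝓝 (g x)) :=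
  ContDiffBump.ae_convolution_tendsto_right_of_locallyIntegrable (K := 2)
    tendsto_mollifier_rOut (Eventually.of_forall fun n => by simp only [mollifier]; linarith)
    hg.locallyIntegrable

lemma norm_mollify_le (g : E → F) (n : ℕ) (x : E) :
    ‖mollify μ n g x‖ ≤ mollify μ n (fun y => ‖g y‖) x := by
  refine (norm_integral_le_integral_norm _).trans (le_of_eq ?_)
  refine integral_congr_ae (.of_forall fun t => ?_)
  simp [norm_smul, abs_of_nonneg ((mollifier n).nonneg_normed t)]

lemma integral_mollify_norm {g : E → F} (hg : Integrable g μ) (n : ℕ) :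
    ∫ x, mollify μ n (fun y => ‖g y‖) x ∂μ = ∫ x, ‖g x‖ ∂μ := by
  have := integral_convolution (ContinuousLinearMap.lsmul ℝ ℝ)
    ((mollifier n).integrable_normed (μ := μ)) hg.norm
  simpa [mollify, (mollifier (E := E) n).integral_normed] using this

/-- Mollifications of an integrable function converge in `L¹`. -/
theorem tendsto_integral_norm_mollify_sub [CompleteSpace F] {g : E → F} (hg : Integrable g μ) :
    Tendsto (fun n => ∫ x, ‖mollify μ n g x - g x‖ ∂μ) atTop (𝓝 0) := by
  set h : ℕ → E → ℝ := fun n => mollify μ n (fun y => ‖g y‖) with hh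
  have hi : ∀ n, Integrable (h n) μ := fun n => integrable_mollify hg.norm n
  have hF : ∀ n, Integrable (fun x => ‖mollify μ n g x - g x‖) μ :=
    fun n => ((integrable_mollify hg n).sub hg).norm
  -- No pointwise majorant of the mollifications is at hand. Instead D ≥ 0, its truncation at 2‖g‖
  -- converges to 2‖g‖ by domination, and mollifying ‖g‖ preserves its integral; so ∫ D exceeds 2 ∫
  -- ‖g‖ in no limit, and the subtracted norm must tend to 0.
  set D : ℕ → E → ℝ := fun n x => h n x + ‖g x‖ - ‖mollify μ n g x - g x‖ with hD
  have hDi : ∀ n, Integrable (D n) μ := fun n => ((hi n).add hg.norm).sub (hF n)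
  have hD0 : ∀ n x, 0 ≤ D n x := fun n x => by
    have := norm_sub_le (mollify μ n g x) (g x)
    have := norm_mollify_le (μ := μ) g n x
    simp only [hD, hh]; linarith
  have hmin : Tendsto (fun n => ∫ x, min (D n x) (2 * ‖g x‖) ∂μ) atTop
      (𝓝 (∫ x, 2 * ‖g x‖ ∂μ)) := by
    refine tendsto_integral_of_dominated_convergence (fun x => 2 * ‖g x‖)
      (fun n => ((hDi n).inf (hg.norm.const_mul 2)).aestronglyMeasurable)
      (hg.norm.const_mul 2) (fun n => .of_forall fun x => ?_) ?_
    · rw [Real.norm_of_nonneg (le_min (hD0 n x) (by positivity))]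
      exact min_le_right _ _
    · filter_upwards [ae_tendsto_mollify hg, ae_tendsto_mollify hg.norm] with x h1 h2
      have h3 : Tendsto (fun n => D n x) atTop (𝓝 (2 * ‖g x‖)) := by
        have := (h2.add_const ‖g x‖).sub (h1.sub_const (g x)).norm
        simp only [sub_self, norm_zero, sub_zero] at this
        rw [two_mul]; exact this
      simpa using h3.min (tendsto_const_nhds (x := 2 * ‖g x‖))
  have hle : ∀ n, ∫ x, ‖mollify μ n g x - g x‖ ∂μ
      ≤ ∫ x, 2 * ‖g x‖ ∂μ - ∫ x, min (D n x) (2 * ‖g x‖) ∂μ := fun n => by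
    have h1 : ∫ x, min (D n x) (2 * ‖g x‖) ∂μ ≤ ∫ x, D n x ∂μ :=
      integral_mono ((hDi n).inf (hg.norm.const_mul 2)) (hDi n) fun x => min_le_left _ _
    have h2 : ∫ x, D n x ∂μ = ∫ x, ‖g x‖ ∂μ + ∫ x, ‖g x‖ ∂μ
        - ∫ x, ‖mollify μ n g x - g x‖ ∂μ := by
      simp only [hD]
      have h3 := integral_sub ((hi n).add hg.norm) (hF n)
      have h4 := integral_add (hi n) hg.norm
      simp only [Pi.add_apply] at h3
      rw [h3, h4, integral_mollify_norm hg]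
    rw [integral_const_mul] at *
    linarith
  refine squeeze_zero (fun n => integral_nonneg fun x => norm_nonneg _) hle ?_
  simpa using hmin.const_sub (∫ x, 2 * ‖g x‖ ∂μ)

/-- `g` is the weak derivative of `w` on `Ω` in the direction `e`. -/
def HasWeakDerivAlong (μ : Measure E) (Ω : Set E) (e : E) (w g : E → F) : Prop :=
  ∀ φ : E → ℝ, ContDiff ℝ ∞ φ → HasCompactSupport φ → tsupport φ ⊆ Ω →
    ∫ x in Ω, fderiv ℝ φ x e • w x ∂μ = - ∫ x in Ω, φ x • g x ∂μ

lemma setIntegral_smul_eq_integral_indicator {Ω : Set E} (hΩ : MeasurableSet Ω) (a : E → ℝ)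
    (w : E → F) : ∫ x in Ω, a x • w x ∂μ = ∫ x, a x • Ω.indicator w x ∂μ := by
  rw [← integral_indicator hΩ]
  congr 1 with x
  by_cases hx : x ∈ Ω <;> simp [hx]

/-- Mollification commutes with weak differentiation away from the boundary. -/
theorem HasWeakDerivAlong.fderiv_mollify [CompleteSpace F] {Ω : Set E} (hΩ : IsOpen Ω) {e : E}
    {w g : E → F} (hw : IntegrableOn w Ω μ) (h : HasWeakDerivAlong μ Ω e w g) {n : ℕ} {x : E}
    (hx : closedBall x (mollifier (E := E) n).rOut ⊆ Ω) :
    fderiv ℝ (mollify μ n (Ω.indicator w)) x e = mollify μ n (Ω.indicator g) x := by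
  have hW : Integrable (Ω.indicator w) μ := (integrable_indicator_iff hΩ.measurableSet).2 hw
  set ρ : E → ℝ := (mollifier n).normed μ with hρ
  have hρs : ContDiff ℝ ∞ ρ := (mollifier n).contDiff_normed
  have hρc : HasCompactSupport ρ := (mollifier n).hasCompactSupport_normed
  have hd := hρc.hasFDerivAt_convolution_left (ContinuousLinearMap.lsmul ℝ ℝ)
    (hρs.of_le (by norm_cast)) hW.locallyIntegrable x
  have hex := (hρc.fderiv ℝ).convolutionExists_left
    ((ContinuousLinearMap.lsmul ℝ ℝ : ℝ →L[ℝ] F →L[ℝ] F).precompL E)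
    (hρs.continuous_fderiv (by simp)) hW.locallyIntegrable x
  rw [mollify, hd.fderiv, convolution_eq_swap, ContinuousLinearMap.integral_apply
    hex.integrable_swap, mollify, convolution_eq_swap]
  simp only [ContinuousLinearMap.precompL_apply, ContinuousLinearMap.lsmul_apply]
  -- The reflected, translated kernel is an admissible test function because its support lies in the
  -- closed ball assumed inside Ω.
  set ψ : E → ℝ := fun y => ρ (x - y) with hψ
  have hψs : ContDiff ℝ ∞ ψ := hρs.comp (contDiff_const.sub contDiff_id)
  have hsupp : tsupport ψ ⊆ closedBall x (mollifier (E := E) n).rOut := by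
    refine closure_minimal (fun y hy => ?_) isClosed_closedBall
    have : x - y ∈ Function.support ρ := hy
    rw [hρ, ContDiffBump.support_normed_eq, mem_ball, dist_zero_right] at this
    rw [mem_closedBall, dist_comm, dist_eq_norm]; exact this.le
  have hψd : ∀ y, fderiv ℝ ψ y e = - fderiv ℝ ρ (x - y) e := fun y => by
    have h1 : HasFDerivAt ψ ((fderiv ℝ ρ (x - y)).comp (-ContinuousLinearMap.id ℝ E)) y :=
      ((hρs.differentiable (by simp)) (x - y)).hasFDerivAt.comp y
        ((hasFDerivAt_id y).const_sub x)
    rw [h1.fderiv]; simp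
  have := h ψ hψs ((isCompact_closedBall x _).of_isClosed_subset (isClosed_tsupport _) hsupp)
    (hsupp.trans hx)
  rw [setIntegral_smul_eq_integral_indicator hΩ.measurableSet,
    setIntegral_smul_eq_integral_indicator hΩ.measurableSet] at this
  simp only [hψd, neg_smul, integral_neg, neg_inj] at this
  exact this

lemma fderiv_eq_zero_of_notMem_tsupport {ψ : E → ℝ} {x : E} (hx : x ∉ tsupport ψ) :
    fderiv ℝ ψ x = 0 := by
  by_contra h
  exact hx (support_fderiv_subset ℝ (f := ψ) h)

lemma aestronglyMeasurable_clm_apply {T : E → F →L[ℝ] F'} {g : E → F}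
    (hT : AEStronglyMeasurable T μ) (hg : AEStronglyMeasurable g μ) :
    AEStronglyMeasurable (fun x => T x (g x)) μ :=
  isBoundedBilinearMap_apply.continuous.comp_aestronglyMeasurable (hT.prodMk hg)

/-- Chain rule for weak derivatives. -/
theorem HasWeakDerivAlong.comp [CompleteSpace F] [CompleteSpace F'] {Ω : Set E} (hΩ : IsOpen Ω)
    {e : E} {w g : E → F} (hw : IntegrableOn w Ω μ) (hg : IntegrableOn g Ω μ)
    (h : HasWeakDerivAlong μ Ω e w g) {G : F → F'} (hG : ContDiff ℝ 1 G) {B C : ℝ}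
    (hB : ∀ y, ‖G y‖ ≤ B) (hC : ∀ y, ‖fderiv ℝ G y‖ ≤ C) :
    HasWeakDerivAlong μ Ω e (fun x => G (w x)) (fun x => fderiv ℝ G (w x) (g x)) := by
  intro ψ hψ hψc hψΩ
  set W := Ω.indicator w with hWdef
  set Γ := Ω.indicator g with hΓdef
  have hW : Integrable W μ := (integrable_indicator_iff hΩ.measurableSet).2 hw
  have hΓ : Integrable Γ μ := (integrable_indicator_iff hΩ.measurableSet).2 hg
  have hψ1 : ContDiff ℝ 1 ψ := hψ.of_le (by norm_cast)
  have hψ'c : Continuous fun x => fderiv ℝ ψ x e := by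
    have := hψ1.continuous_fderiv one_ne_zero
    fun_prop
  have hψ's : HasCompactSupport fun x => fderiv ℝ ψ x e := hψc.fderiv_apply ℝ e
  have hψi : Integrable (fun x => fderiv ℝ ψ x e) μ := hψ'c.integrable_of_hasCompactSupport hψ's
  obtain ⟨A, hA⟩ := hψc.exists_bound_of_continuous hψ.continuous
  have hC0 : 0 ≤ C := (norm_nonneg _).trans (hC 0)
  have hA0 : 0 ≤ A := (norm_nonneg _).trans (hA 0)
  have hGd : Continuous (fderiv ℝ G) := hG.continuous_fderiv one_ne_zero
  -- both sides as integrals over the whole space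
  have hL : ∫ x in Ω, fderiv ℝ ψ x e • G (w x) ∂μ = ∫ x, fderiv ℝ ψ x e • G (W x) ∂μ := by
    rw [← integral_indicator hΩ.measurableSet]
    congr 1 with x
    by_cases hx : x ∈ Ω
    · simp [hx, hWdef]
    · simp [hx, fderiv_eq_zero_of_notMem_tsupport (fun h => hx (hψΩ h))]
  have hR : ∫ x in Ω, ψ x • fderiv ℝ G (w x) (g x) ∂μ
      = ∫ x, ψ x • fderiv ℝ G (W x) (Γ x) ∂μ := by
    rw [← integral_indicator hΩ.measurableSet]
    congr 1 with x
    by_cases hx : x ∈ Ω <;> simp [hx, hWdef, hΓdef]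
  rw [hL, hR]
  set wn := fun n => mollify μ n W with hwn
  have hwns : ∀ n, ContDiff ℝ 1 (wn n) := fun n => (contDiff_mollify hW n).of_le (by norm_cast)
  -- the identity for mollifications
  obtain ⟨δ, hδ, hδΩ⟩ := hψc.isCompact.exists_cthickening_subset_open hΩ hψΩ
  have hid : ∀ᶠ n in atTop, ∫ x, fderiv ℝ ψ x e • G (wn n x) ∂μ
      = - ∫ x, ψ x • fderiv ℝ G (wn n x) (mollify μ n Γ x) ∂μ := by
    filter_upwards [(tendsto_mollifier_rOut (E := E)).eventually (gt_mem_nhds hδ)] with n hn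
    have hGw : ContDiff ℝ 1 fun x => G (wn n x) := hG.comp (hwns n)
    have hGw' : Continuous fun x => fderiv ℝ (fun x => G (wn n x)) x e := by
      have := hGw.continuous_fderiv one_ne_zero
      fun_prop
    have hparts := integral_smul_fderiv_eq_neg_fderiv_smul_of_integrable (μ := μ) (f := ψ)
      (g := fun x => G (wn n x)) (v := e)
      ((hψ'c.smul hGw.continuous).integrable_of_hasCompactSupport hψ's.smul_right)
      ((hψ.continuous.smul hGw').integrable_of_hasCompactSupport hψc.smul_right)
      ((hψ.continuous.smul hGw.continuous).integrable_of_hasCompactSupport hψc.smul_right)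
      (fun x _ => hψ1.differentiable one_ne_zero x)
      (fun x _ => hGw.differentiable one_ne_zero x)
    rw [← neg_eq_iff_eq_neg, ← hparts]
    refine integral_congr_ae (.of_forall fun x => ?_)
    by_cases hx : x ∈ tsupport ψ
    · have hball : closedBall x (mollifier (E := E) n).rOut ⊆ Ω :=
        ((closedBall_subset_closedBall hn.le).trans
          (closedBall_subset_cthickening hx δ)).trans hδΩ
      have hd : fderiv ℝ (fun x => G (wn n x)) x
          = (fderiv ℝ G (wn n x)).comp (fderiv ℝ (wn n) x) :=
        ((hG.differentiable one_ne_zero _).hasFDerivAt.comp x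
          ((hwns n).differentiable one_ne_zero x).hasFDerivAt).fderiv
      simp only [hd, ContinuousLinearMap.comp_apply]
      rw [hwn, h.fderiv_mollify hΩ hw hball]
    · simp [image_eq_zero_of_notMem_tsupport hx]
  have hae := ae_tendsto_mollify hW
  have hlimL : Tendsto (fun n => ∫ x, fderiv ℝ ψ x e • G (wn n x) ∂μ) atTop
      (𝓝 (∫ x, fderiv ℝ ψ x e • G (W x) ∂μ)) := by
    refine tendsto_integral_of_dominated_convergence (fun x => ‖fderiv ℝ ψ x e‖ * B)
      (fun n => (hψ'c.smul (hG.continuous.comp (hwns n).continuous)).aestronglyMeasurable)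
      (hψi.norm.mul_const B) (fun n => .of_forall fun x => ?_) ?_
    · rw [norm_smul]; gcongr; exact hB _
    · filter_upwards [hae] with x hx
      exact ((hG.continuous.tendsto _).comp hx).const_smul _
  have hmeas : AEStronglyMeasurable (fun x => fderiv ℝ G (W x) (Γ x)) μ :=
    aestronglyMeasurable_clm_apply (hGd.comp_aestronglyMeasurable hW.1) hΓ.1
  have hbd : ∀ y (v : F), ‖fderiv ℝ G y v‖ ≤ C * ‖v‖ := fun y v =>
    ((fderiv ℝ G y).le_opNorm v).trans (by gcongr; exact hC y)
  have hi1 : Integrable (fun x => ψ x • fderiv ℝ G (W x) (Γ x)) μ := by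
    refine ((hΓ.norm.const_mul (A * C))).mono' (hψ.continuous.aestronglyMeasurable.smul hmeas)
      (.of_forall fun x => ?_)
    rw [norm_smul, mul_assoc]
    exact mul_le_mul (hA x) (hbd _ _) (norm_nonneg _) hA0
  have hi2 : ∀ n, Integrable (fun x => ψ x • fderiv ℝ G (wn n x) (Γ x)) μ := fun n => by
    refine ((hΓ.norm.const_mul (A * C))).mono' (hψ.continuous.aestronglyMeasurable.smul
      (aestronglyMeasurable_clm_apply (hGd.comp (hwns n).continuous).aestronglyMeasurable hΓ.1))
      (.of_forall fun x => ?_)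
    rw [norm_smul, mul_assoc]
    exact mul_le_mul (hA x) (hbd _ _) (norm_nonneg _) hA0
  have hd3 : ∀ n, Integrable (fun x => mollify μ n Γ x - Γ x) μ :=
    fun n => (integrable_mollify hΓ n).sub hΓ
  have hi3 : ∀ n, Integrable (fun x => ψ x • fderiv ℝ G (wn n x) (mollify μ n Γ x - Γ x)) μ :=
    fun n => by
    refine (((hd3 n).norm.const_mul (A * C))).mono' (hψ.continuous.aestronglyMeasurable.smul
      (aestronglyMeasurable_clm_apply (hGd.comp (hwns n).continuous).aestronglyMeasurable (hd3 n).1))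
      (.of_forall fun x => ?_)
    rw [norm_smul, mul_assoc]
    exact mul_le_mul (hA x) (hbd _ _) (norm_nonneg _) hA0
  -- The right side is split into the derivative of G at `wn n` applied to Γ, which converges by
  -- domination, and the same applied to the mollification error of Γ, which tends to 0 by L¹
  -- convergence.
  have hlim2 : Tendsto (fun n => ∫ x, ψ x • fderiv ℝ G (wn n x) (Γ x) ∂μ) atTop
      (𝓝 (∫ x, ψ x • fderiv ℝ G (W x) (Γ x) ∂μ)) := by
    refine tendsto_integral_of_dominated_convergence (fun x => A * C * ‖Γ x‖)
      (fun n => (hi2 n).1) (hΓ.norm.const_mul _) (fun n => .of_forall fun x => ?_) ?_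
    · rw [norm_smul, mul_assoc]
      exact mul_le_mul (hA x) (hbd _ _) (norm_nonneg _) hA0
    · filter_upwards [hae] with x hx
      exact ((((ContinuousLinearMap.apply ℝ F' (Γ x)).continuous.comp hGd).tendsto _).comp hx).const_smul _
  have hlim3 : Tendsto (fun n => ∫ x, ψ x • fderiv ℝ G (wn n x) (mollify μ n Γ x - Γ x) ∂μ)
      atTop (𝓝 0) := by
    refine squeeze_zero_norm (a := fun n => A * C * ∫ x, ‖mollify μ n Γ x - Γ x‖ ∂μ)
      (fun n => ?_) ?_
    · rw [← integral_const_mul]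
      refine norm_integral_le_of_norm_le ((hd3 n).norm.const_mul _) (.of_forall fun x => ?_)
      rw [norm_smul, mul_assoc]
      exact mul_le_mul (hA x) (hbd _ _) (norm_nonneg _) hA0
    · simpa using (tendsto_integral_norm_mollify_sub hΓ).const_mul (A * C)
  have hlimR : Tendsto (fun n => ∫ x, ψ x • fderiv ℝ G (wn n x) (mollify μ n Γ x) ∂μ) atTop
      (𝓝 (∫ x, ψ x • fderiv ℝ G (W x) (Γ x) ∂μ)) := by
    have := hlim2.add hlim3
    rw [add_zero] at this
    refine this.congr fun n => ?_
    rw [← integral_add (hi2 n) (hi3 n)]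
    congr 1 with x
    rw [← smul_add, ← map_add, add_sub_cancel]
  exact tendsto_nhds_unique (hlimL.congr' hid) hlimR.neg

/-- Product rule for weak derivatives with a smooth factor. -/
theorem HasWeakDerivAlong.smul {Ω : Set E} {e : E} {w g : E → F}
    (hw : IntegrableOn w Ω μ) (hg : IntegrableOn g Ω μ)
    (h : HasWeakDerivAlong μ Ω e w g) {θ : E → ℝ} (hθ : ContDiff ℝ ∞ θ) :
    HasWeakDerivAlong μ Ω e (fun x => θ x • w x) (fun x => θ x • g x + fderiv ℝ θ x e • w x) := by
  intro ψ hψ hψc hψΩ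
  have hψ1 : ContDiff ℝ 1 ψ := hψ.of_le (by norm_cast)
  have hθ1 : ContDiff ℝ 1 θ := hθ.of_le (by norm_cast)
  have hd : ∀ x, fderiv ℝ (fun y => θ y * ψ y) x e
      = θ x * fderiv ℝ ψ x e + ψ x * fderiv ℝ θ x e := fun x => by
    have := ((hθ1.differentiable one_ne_zero x).hasFDerivAt.mul
      (hψ1.differentiable one_ne_zero x).hasFDerivAt).fderiv
    change fderiv ℝ (θ * ψ) x e = _
    rw [this]; simp
  have hint : ∀ (a : E → ℝ) (f : E → F), Continuous a → HasCompactSupport a →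
      IntegrableOn f Ω μ → IntegrableOn (fun x => a x • f x) Ω μ := fun a f ha hac hf => by
    obtain ⟨A, hA⟩ := hac.exists_bound_of_continuous ha
    exact hf.bdd_smul A ha.aestronglyMeasurable (.of_forall hA)
  have hψ'c : Continuous fun x => fderiv ℝ ψ x e := by
    have := hψ1.continuous_fderiv one_ne_zero
    fun_prop
  have hθ'c : Continuous fun x => fderiv ℝ θ x e := by
    have := hθ1.continuous_fderiv one_ne_zero
    fun_prop
  -- The weak derivative of w is tested with θψ; the term ψ ∂θ of its derivative becomes the extra
  -- term of the product rule.
  have := h (fun y => θ y * ψ y) (hθ.mul hψ) hψc.mul_left ((tsupport_mul_subset_right).trans hψΩ)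
  have i1 := hint (fun x => θ x * fderiv ℝ ψ x e) w (hθ.continuous.mul hψ'c)
    (hψc.fderiv_apply ℝ e).mul_left hw
  have i2 := hint (fun x => ψ x * fderiv ℝ θ x e) w (hψ.continuous.mul hθ'c) hψc.mul_right hw
  have i3 := hint (fun x => ψ x * θ x) g (hψ.continuous.mul hθ.continuous) hψc.mul_right hg
  simp only [hd, add_smul] at this
  rw [integral_add i1 i2] at this
  simp only [smul_add, smul_smul]
  rw [integral_add i3 i2]
  simp only [mul_comm (θ _)] at this
  rw [neg_add, ← this]
  abel

theorem HasWeakDerivAlong.add {Ω : Set E} {e : E} {w g w' g' : E → F}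
    (hw : IntegrableOn w Ω μ) (hg : IntegrableOn g Ω μ) (hw' : IntegrableOn w' Ω μ)
    (hg' : IntegrableOn g' Ω μ) (h : HasWeakDerivAlong μ Ω e w g)
    (h' : HasWeakDerivAlong μ Ω e w' g') :
    HasWeakDerivAlong μ Ω e (fun x => w x + w' x) (fun x => g x + g' x) := by
  intro ψ hψ hψc hψΩ
  have hψ1 : ContDiff ℝ 1 ψ := hψ.of_le (by norm_cast)
  have hint : ∀ (a : E → ℝ) (f : E → F), Continuous a → HasCompactSupport a →
      IntegrableOn f Ω μ → IntegrableOn (fun x => a x • f x) Ω μ := fun a f ha hac hf => by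
    obtain ⟨A, hA⟩ := hac.exists_bound_of_continuous ha
    exact hf.bdd_smul A ha.aestronglyMeasurable (.of_forall hA)
  have hψ'c : Continuous fun x => fderiv ℝ ψ x e := by
    have := hψ1.continuous_fderiv one_ne_zero
    fun_prop
  simp only [smul_add]
  rw [integral_add (hint _ _ hψ'c (hψc.fderiv_apply ℝ e) hw)
    (hint _ _ hψ'c (hψc.fderiv_apply ℝ e) hw'), integral_add (hint _ _ hψ.continuous hψc hg)
    (hint _ _ hψ.continuous hψc hg'), h ψ hψ hψc hψΩ, h' ψ hψ hψc hψΩ, neg_add]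

theorem hasWeakDerivAlong_const [CompleteSpace F] {Ω : Set E} (hΩ : MeasurableSet Ω) (e : E)
    (c : F) : HasWeakDerivAlong μ Ω e (fun _ => c) (fun _ => 0) := by
  intro ψ hψ hψc hψΩ
  have hψ1 : ContDiff ℝ 1 ψ := hψ.of_le (by norm_cast)
  have hψ'c : Continuous fun x => fderiv ℝ ψ x e := by
    have := hψ1.continuous_fderiv one_ne_zero
    fun_prop
  have hpart := integral_smul_fderiv_eq_neg_fderiv_smul_of_integrable (μ := μ) (f := ψ)
    (g := fun _ => c) (v := e)
    ((hψ'c.smul continuous_const).integrable_of_hasCompactSupport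
      (hψc.fderiv_apply ℝ e).smul_right) (by simp)
    ((hψ.continuous.smul continuous_const).integrable_of_hasCompactSupport hψc.smul_right)
    (fun x _ => hψ1.differentiable one_ne_zero x) (fun x _ => by fun_prop)
  have hL : ∫ x in Ω, fderiv ℝ ψ x e • c ∂μ = ∫ x, fderiv ℝ ψ x e • c ∂μ := by
    rw [← integral_indicator hΩ]
    congr 1 with x
    by_cases hx : x ∈ Ω
    · simp [hx]
    · simp [hx, fderiv_eq_zero_of_notMem_tsupport (fun h => hx (hψΩ h))]
  rw [hL, ← neg_eq_iff_eq_neg, ← hpart]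
  simp

end WeakDerivative
end ReversePoincare

namespace ReversePoincare

/-! ### The radial projection onto the sphere and its regularization -/

section Retraction

set_option linter.unusedSectionVars false

open Filter
open scoped Topology RealInnerProductSpace

variable {V : Type*} [NormedAddCommGroup V] [InnerProductSpace ℝ V]

/-- The regularized length `√(‖z‖² + ε²)`. -/
noncomputable def regLength (ε : ℝ) (z : V) : ℝ := √(‖z‖ ^ 2 + ε ^ 2)

/-- The regularized direction `z / √(‖z‖² + ε²)`. -/
noncomputable def regDirection (ε : ℝ) (z : V) : V := (regLength ε z)⁻¹ • z

/-- For a unit vector `y`, the number `t ≥ 0` with `‖a + t • y‖ = 1`. -/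
noncomputable def rayLength (a y : V) : ℝ := -⟪a, y⟫ + √(⟪a, y⟫ ^ 2 + (1 - ‖a‖ ^ 2))

/-- The radial projection with centre `a` onto the unit sphere, regularized at scale `ε`
(and not regularized for `ε = 0`). -/
noncomputable def radialProj (a : V) (ε : ℝ) (w : V) : V :=
  a + rayLength a (regDirection ε (w - a)) • regDirection ε (w - a)

lemma regLength_pos {ε : ℝ} {z : V} (h : ε ≠ 0 ∨ z ≠ 0) : 0 < regLength ε z := by
  refine Real.sqrt_pos.2 ?_
  rcases h with h | h
  · positivity
  · have := norm_pos_iff.2 h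
    positivity

lemma norm_le_regLength (ε : ℝ) (z : V) : ‖z‖ ≤ regLength ε z :=
  Real.le_sqrt_of_sq_le (by nlinarith [sq_nonneg ε])

lemma norm_regDirection_le (ε : ℝ) (z : V) : ‖regDirection ε z‖ ≤ 1 := by
  have h0 : 0 ≤ regLength ε z := Real.sqrt_nonneg _
  rw [regDirection, norm_smul, norm_inv, Real.norm_of_nonneg h0]
  exact inv_mul_le_one_of_le₀ (norm_le_regLength ε z) (Real.sqrt_nonneg _)

lemma one_sub_norm_sq_pos {a : V} (ha : ‖a‖ < 1) : 0 < 1 - ‖a‖ ^ 2 := by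
  nlinarith [norm_nonneg a]

lemma abs_inner_le_one {a y : V} (ha : ‖a‖ < 1) (hy : ‖y‖ ≤ 1) : |⟪a, y⟫| ≤ 1 :=
  (abs_real_inner_le_norm a y).trans (mul_le_one₀ ha.le (norm_nonneg _) hy)

/-- Stated for ‖y‖ ≤ 1 rather than for unit vectors, because regularized directions are shorter than
1. -/
lemma abs_rayLength_le {a y : V} (ha : ‖a‖ < 1) (hy : ‖y‖ ≤ 1) : |rayLength a y| ≤ 3 := by
  have h1 := abs_inner_le_one ha hy
  have h2 : √(⟪a, y⟫ ^ 2 + (1 - ‖a‖ ^ 2)) ≤ 2 := by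
    refine Real.sqrt_le_iff.2 ⟨by norm_num, ?_⟩
    nlinarith [sq_abs ⟪a, y⟫, abs_nonneg ⟪a, y⟫, sq_nonneg ‖a‖]
  rw [rayLength]
  refine (abs_add_le _ _).trans ?_
  rw [abs_neg, abs_of_nonneg (Real.sqrt_nonneg _)]
  linarith

/-- Uniformity in ε is the point: it supplies the majorant for the limit ε → 0. -/
lemma norm_radialProj_le {a : V} (ha : ‖a‖ < 1) (ε : ℝ) (w : V) : ‖radialProj a ε w‖ ≤ 4 := by
  have h1 := abs_rayLength_le ha (norm_regDirection_le ε (w - a))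
  have h2 := norm_regDirection_le ε (w - a)
  calc ‖radialProj a ε w‖ ≤ ‖a‖ + |rayLength a (regDirection ε (w - a))| *
        ‖regDirection ε (w - a)‖ := by
        rw [radialProj, ← Real.norm_eq_abs, ← norm_smul]; exact norm_add_le _ _
    _ ≤ 1 + 3 * 1 := by gcongr
    _ = 4 := by norm_num

lemma regLength_zero (z : V) : regLength 0 z = ‖z‖ := by
  simp [regLength]

/-- For a unit vector y, `rayLength a y` is a root t of t² + 2t⟪a, y⟫ = 1 - ‖a‖², which says ‖a + t
• y‖ = 1. -/
theorem norm_radialProj_zero {a w : V} (ha : ‖a‖ < 1) (hw : w ≠ a) :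
    ‖radialProj a 0 w‖ = 1 := by
  have hz : 0 < ‖w - a‖ := norm_pos_iff.2 (sub_ne_zero.2 hw)
  have he : ‖regDirection 0 (w - a)‖ = 1 := by
    rw [regDirection, regLength_zero, norm_smul, norm_inv, norm_norm, inv_mul_cancel₀ hz.ne']
  set e := regDirection 0 (w - a) with hedef
  have hs := Real.sq_sqrt (show 0 ≤ ⟪a, e⟫ ^ 2 + (1 - ‖a‖ ^ 2) by
    have := one_sub_norm_sq_pos ha; positivity)
  have hsq : ‖radialProj a 0 w‖ ^ 2 = 1 := by
    rw [radialProj, ← hedef, norm_add_sq_real, inner_smul_right, norm_smul, he, mul_one,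
      Real.norm_eq_abs, sq_abs, rayLength]
    linear_combination hs
  exact (pow_eq_one_iff_of_nonneg (norm_nonneg _) two_ne_zero).1 hsq

/-- The ray from a through a unit vector w meets the sphere at w, at distance ‖w - a‖. This is why
the competitor keeps the boundary values of u. -/
theorem radialProj_zero_of_norm_eq_one {a w : V} (ha : ‖a‖ < 1) (hw : ‖w‖ = 1) :
    radialProj a 0 w = w := by
  have hne : w - a ≠ 0 := sub_ne_zero.2 fun h => by rw [h] at hw; linarith
  have hz : 0 < ‖w - a‖ := norm_pos_iff.2 hne
  have hexp : ‖w - a‖ ^ 2 + 2 * ⟪a, w - a⟫ = 1 - ‖a‖ ^ 2 := by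
    have := norm_add_sq_real a (w - a)
    rw [add_sub_cancel, hw] at this
    linarith
  have haw : ⟪a, w⟫ < 1 := by
    have := (abs_le.1 (abs_real_inner_le_norm a w)).2
    rw [hw, mul_one] at this
    linarith
  have hin : ⟪a, w - a⟫ = ⟪a, w⟫ - ‖a‖ ^ 2 := by rw [inner_sub_right, real_inner_self_eq_norm_sq]
  have hray : rayLength a (regDirection 0 (w - a)) = ‖w - a‖ := by
    rw [rayLength, regDirection, regLength_zero, inner_smul_right]
    -- The discriminant is a perfect square; this sign, which comes from ⟪a, w⟫ < 1, selects its
    -- root.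
    have hnn : 0 ≤ ‖w - a‖ + ‖w - a‖⁻¹ * ⟪a, w - a⟫ := by
      have : ‖w - a‖ + ‖w - a‖⁻¹ * ⟪a, w - a⟫ = ‖w - a‖⁻¹ * (‖w - a‖ ^ 2 + ⟪a, w - a⟫) := by
        field_simp
      rw [this]
      refine mul_nonneg (by positivity) ?_
      linarith
    have : (‖w - a‖⁻¹ * ⟪a, w - a⟫) ^ 2 + (1 - ‖a‖ ^ 2)
        = (‖w - a‖ + ‖w - a‖⁻¹ * ⟪a, w - a⟫) ^ 2 := by
      rw [← hexp]
      field_simp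
      ring
    rw [this, Real.sqrt_sq hnn]
    ring
  rw [radialProj, hray, regDirection, regLength_zero, smul_smul, mul_inv_cancel₀ hz.ne', one_smul,
    add_sub_cancel]

/-- The derivative of `regDirection ε`. -/
noncomputable def regDirectionDeriv (ε : ℝ) (z : V) : V →L[ℝ] V :=
  (regLength ε z)⁻¹ • ContinuousLinearMap.id ℝ V
    - ((regLength ε z)⁻¹ ^ 3) • (innerSL ℝ z).smulRight z

/-- The derivative of `rayLength a`. -/
noncomputable def rayLengthDeriv (a y : V) : V →L[ℝ] ℝ :=
  (-1 + ⟪a, y⟫ / √(⟪a, y⟫ ^ 2 + (1 - ‖a‖ ^ 2))) • innerSL ℝ a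

/-- The derivative of `radialProj a ε`. -/
noncomputable def radialProjDeriv (a : V) (ε : ℝ) (w : V) : V →L[ℝ] V :=
  (rayLength a (regDirection ε (w - a)) • ContinuousLinearMap.id ℝ V +
    (rayLengthDeriv a (regDirection ε (w - a))).smulRight (regDirection ε (w - a))).comp
    (regDirectionDeriv ε (w - a))

lemma hasFDerivAt_regLength {ε : ℝ} {z : V} (h : ε ≠ 0 ∨ z ≠ 0) :
    HasFDerivAt (regLength ε) ((regLength ε z)⁻¹ • innerSL ℝ z) z := by
  have hpos := regLength_pos h
  have h0 : ‖z‖ ^ 2 + ε ^ 2 ≠ 0 := (Real.sqrt_pos.1 hpos).ne'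
  have h1 : HasFDerivAt (fun z : V => ‖z‖ ^ 2 + ε ^ 2) (2 • innerSL ℝ z) z :=
    (hasStrictFDerivAt_norm_sq z).hasFDerivAt.add_const _
  have h2 := h1.sqrt h0
  refine h2.congr_fderiv ?_
  ext v
  simp only [regLength, smul_apply, smul_eq_mul, nsmul_eq_mul]
  field_simp
  simp

lemma hasFDerivAt_regDirection {ε : ℝ} {z : V} (h : ε ≠ 0 ∨ z ≠ 0) :
    HasFDerivAt (regDirection ε) (regDirectionDeriv ε z) z := by
  have hpos := regLength_pos h
  have h1 : HasFDerivAt (fun z : V => (regLength ε z)⁻¹) _ z :=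
    (hasDerivAt_inv hpos.ne').comp_hasFDerivAt z (hasFDerivAt_regLength h)
  refine (h1.smul (hasFDerivAt_id z)).congr_fderiv ?_
  ext v
  simp only [regDirectionDeriv, add_apply, smul_apply,
    ContinuousLinearMap.smulRight_apply, id,
    ContinuousLinearMap.id_apply, innerSL_apply_apply, smul_smul, sub_eq_add_neg, ← neg_smul,
    smul_eq_mul]
  congr 2
  field_simp

lemma hasFDerivAt_rayLength {a : V} (ha : ‖a‖ < 1) (y : V) :
    HasFDerivAt (rayLength a) (rayLengthDeriv a y) y := by
  have h0 : ⟪a, y⟫ ^ 2 + (1 - ‖a‖ ^ 2) ≠ 0 := by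
    have := one_sub_norm_sq_pos ha; positivity
  have h1 : HasFDerivAt (fun y : V => ⟪a, y⟫) (innerSL ℝ a) y := (innerSL ℝ a).hasFDerivAt
  have h2 := h1.neg.add (((h1.pow 2).add_const (1 - ‖a‖ ^ 2)).sqrt h0)
  refine h2.congr_fderiv ?_
  ext v
  simp only [rayLengthDeriv, add_apply, smul_apply,
    neg_apply, innerSL_apply_apply, smul_eq_mul]
  have := Real.sqrt_ne_zero'.2 (lt_of_le_of_ne (by
    have := one_sub_norm_sq_pos ha; positivity) h0.symm)
  field_simp
  simp
  ring

lemma hasFDerivAt_radialProj {a : V} (ha : ‖a‖ < 1) {ε : ℝ} {w : V} (h : ε ≠ 0 ∨ w ≠ a) :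
    HasFDerivAt (radialProj a ε) (radialProjDeriv a ε w) w := by
  have h' : ε ≠ 0 ∨ w - a ≠ 0 := h.imp_right sub_ne_zero.2
  have h1 : HasFDerivAt (fun w : V => w - a) (ContinuousLinearMap.id ℝ V) w :=
    (hasFDerivAt_id w).sub_const a
  have h2 : HasFDerivAt (fun w : V => regDirection ε (w - a)) (regDirectionDeriv ε (w - a)) w := by
    have := HasFDerivAt.comp (g := regDirection ε) w (hasFDerivAt_regDirection h') h1
    rwa [ContinuousLinearMap.comp_id] at this
  have h3 := ((hasFDerivAt_rayLength ha (regDirection ε (w - a))).smul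
    (hasFDerivAt_id (regDirection ε (w - a)))).comp w h2
  exact (h3.const_add a)

lemma continuous_regLength : Continuous fun p : ℝ × V => regLength p.1 p.2 := by
  unfold regLength; fun_prop

/-- Joint continuity has two uses: for fixed ε ≠ 0 it makes the regularized projection C¹, and for
fixed w ≠ a it gives the limit ε → 0 of the derivatives. -/
lemma continuousAt_radialProjDeriv {a : V} (ha : ‖a‖ < 1) {ε : ℝ} {w : V} (h : ε ≠ 0 ∨ w ≠ a) :
    ContinuousAt (fun p : ℝ × V => radialProjDeriv a p.1 p.2) (ε, w) := by
  have hpos := (regLength_pos (h.imp_right sub_ne_zero.2)).ne'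
  have h1 : ContinuousAt (fun p : ℝ × V => (regLength p.1 (p.2 - a))⁻¹) (ε, w) := by
    refine ContinuousAt.inv₀ ?_ hpos
    exact (continuous_regLength.comp
      (continuous_fst.prodMk (continuous_snd.sub continuous_const))).continuousAt
  have h2 : ContinuousAt (fun p : ℝ × V => regDirection p.1 (p.2 - a)) (ε, w) :=
    h1.smul (by fun_prop)
  have h3 : Continuous (rayLength a) := by unfold rayLength; fun_prop
  have h4 : Continuous (rayLengthDeriv a) := by
    unfold rayLengthDeriv
    have hne : ∀ y : V, √(⟪a, y⟫ ^ 2 + (1 - ‖a‖ ^ 2)) ≠ 0 := fun y => by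
      have := one_sub_norm_sq_pos ha
      positivity
    have hc : Continuous fun y : V => ⟪a, y⟫ / √(⟪a, y⟫ ^ 2 + (1 - ‖a‖ ^ 2)) :=
      Continuous.div (by fun_prop) (by fun_prop) hne
    exact (continuous_const.add hc).smul continuous_const
  have h5 : ContinuousAt (fun p : ℝ × V => regDirectionDeriv p.1 (p.2 - a)) (ε, w) := by
    unfold regDirectionDeriv
    refine (h1.smul continuousAt_const).sub ((h1.pow 3).smul ?_)
    exact (((ContinuousLinearMap.smulRightL ℝ V V).continuous₂.comp
      (((innerSL ℝ).continuous.comp (continuous_snd.sub continuous_const)).prodMk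
        (continuous_snd.sub continuous_const) : Continuous fun p : ℝ × V =>
          (innerSL ℝ (p.2 - a), p.2 - a))).continuousAt)
  have h6 : ContinuousAt (fun p : ℝ × V => (rayLengthDeriv a (regDirection p.1 (p.2 - a))).smulRight
      (regDirection p.1 (p.2 - a))) (ε, w) :=
    ((ContinuousLinearMap.smulRightL ℝ V V).continuous₂.continuousAt).comp
      (f := fun p : ℝ × V => (rayLengthDeriv a (regDirection p.1 (p.2 - a)),
        regDirection p.1 (p.2 - a)))
      ((h4.continuousAt.comp h2).prodMk h2)
  exact ((((h3.continuousAt.comp h2).smul continuousAt_const).add h6).clm_comp h5)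

lemma contDiff_radialProj {a : V} (ha : ‖a‖ < 1) {ε : ℝ} (hε : ε ≠ 0) :
    ContDiff ℝ 1 (radialProj a ε) := by
  have hd : ∀ w, HasFDerivAt (radialProj a ε) (radialProjDeriv a ε w) w :=
    fun w => hasFDerivAt_radialProj ha (.inl hε)
  refine contDiff_one_iff_fderiv.2 ⟨fun w => (hd w).differentiableAt, ?_⟩
  rw [show fderiv ℝ (radialProj a ε) = radialProjDeriv a ε from funext fun w => (hd w).fderiv]
  refine continuous_iff_continuousAt.2 fun w => ?_
  exact (continuousAt_radialProjDeriv ha (w := w) (.inl hε)).comp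
    (f := fun w => ((ε, w) : ℝ × V)) (by fun_prop)

/-- With ℓ the regularized length and y = z/ℓ, the derivative is ℓ⁻¹ (id - y ⊗ y), and ‖y‖ ≤ 1. -/
lemma norm_regDirectionDeriv_le (ε : ℝ) (z : V) :
    ‖regDirectionDeriv ε z‖ ≤ 2 * (regLength ε z)⁻¹ := by
  have h0 : 0 ≤ regLength ε z := Real.sqrt_nonneg _
  have hz := norm_le_regLength ε z
  refine ContinuousLinearMap.opNorm_le_bound _ (by positivity) fun v => ?_
  have h1 : ‖regDirectionDeriv ε z v‖ ≤ (regLength ε z)⁻¹ * ‖v‖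
      + (regLength ε z)⁻¹ ^ 3 * (‖z‖ * ‖v‖ * ‖z‖) := by
    simp only [regDirectionDeriv, sub_apply, smul_apply,
      ContinuousLinearMap.id_apply, ContinuousLinearMap.smulRight_apply, innerSL_apply_apply]
    refine (norm_sub_le _ _).trans ?_
    rw [norm_smul, norm_smul, norm_smul, Real.norm_of_nonneg (by positivity : 0 ≤ (regLength ε z)⁻¹),
      Real.norm_of_nonneg (by positivity : 0 ≤ (regLength ε z)⁻¹ ^ 3)]
    gcongr
    exact norm_inner_le_norm z v
  have h2 : (regLength ε z)⁻¹ * ‖z‖ ≤ 1 := inv_mul_le_one_of_le₀ hz h0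
  have h3 : (regLength ε z)⁻¹ ^ 3 * (‖z‖ * ‖v‖ * ‖z‖)
      = ((regLength ε z)⁻¹ * ‖z‖) ^ 2 * ((regLength ε z)⁻¹ * ‖v‖) := by ring
  have h4 : ((regLength ε z)⁻¹ * ‖z‖) ^ 2 ≤ 1 := pow_le_one₀ (by positivity) h2
  rw [h3] at h1
  nlinarith [mul_nonneg (sub_nonneg.2 h4)
    (by positivity : 0 ≤ (regLength ε z)⁻¹ * ‖v‖)]

lemma norm_rayLengthDeriv_le {a : V} (ha : ‖a‖ < 1) (y : V) : ‖rayLengthDeriv a y‖ ≤ 2 := by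
  have hpos := one_sub_norm_sq_pos ha
  rw [rayLengthDeriv, norm_smul, innerSL_apply_norm]
  have h1 : |⟪a, y⟫ / √(⟪a, y⟫ ^ 2 + (1 - ‖a‖ ^ 2))| ≤ 1 := by
    rw [abs_div, abs_of_nonneg (Real.sqrt_nonneg _)]
    refine div_le_one_of_le₀ (Real.abs_le_sqrt (by linarith)) (Real.sqrt_nonneg _)
  have h2 : ‖-1 + ⟪a, y⟫ / √(⟪a, y⟫ ^ 2 + (1 - ‖a‖ ^ 2))‖ ≤ 1 + 1 := by
    refine (norm_add_le _ _).trans ?_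
    rw [norm_neg, norm_one]
    gcongr
    exact h1
  refine (mul_le_mul h2 ha.le (norm_nonneg _) (by norm_num)).trans (by norm_num)

/-- The factor 10 is (3 + 2) · 2: the bounds for the ray length, its derivative and the derivative
of the direction. It depends neither on a nor on ε. -/
theorem norm_radialProjDeriv_le {a : V} (ha : ‖a‖ < 1) (ε : ℝ) (w : V) :
    ‖radialProjDeriv a ε w‖ ≤ 10 * (regLength ε (w - a))⁻¹ := by
  set y := regDirection ε (w - a) with hy
  have hy1 : ‖y‖ ≤ 1 := norm_regDirection_le _ _
  have h1 : ‖rayLength a y • ContinuousLinearMap.id ℝ V + (rayLengthDeriv a y).smulRight y‖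
      ≤ 5 := by
    refine (norm_add_le _ _).trans ?_
    rw [norm_smul, ContinuousLinearMap.norm_smulRight_apply]
    have h2 := mul_le_mul (abs_rayLength_le ha hy1)
      (ContinuousLinearMap.norm_id_le (𝕜 := ℝ) (E := V)) (norm_nonneg _) (by norm_num)
    have h3 := mul_le_mul (norm_rayLengthDeriv_le ha y) hy1 (norm_nonneg _) (by norm_num)
    rw [← Real.norm_eq_abs] at h2
    linarith
  calc ‖radialProjDeriv a ε w‖ ≤ 5 * (2 * (regLength ε (w - a))⁻¹) := by
        refine (ContinuousLinearMap.opNorm_comp_le _ _).trans ?_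
        gcongr
        exact norm_regDirectionDeriv_le _ _
    _ = _ := by ring

end Retraction
end ReversePoincare

namespace ReversePoincare

/-! ### Weak chain rule for the singular projection -/

section SingularChainRule

set_option linter.unusedSectionVars false

open Filter
open scoped Topology RealInnerProductSpace

variable {E V : Type*} [NormedAddCommGroup E] [NormedSpace ℝ E] [FiniteDimensional ℝ E]
  [MeasurableSpace E] [BorelSpace E] [NormedAddCommGroup V] [InnerProductSpace ℝ V]
  [CompleteSpace V] {μ : Measure E}

lemma tendsto_radialProj {a w : V} (hw : w ≠ a) {ε : ℕ → ℝ}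
    (hε : Tendsto ε atTop (𝓝 0)) :
    Tendsto (fun n => radialProj a (ε n) w) atTop (𝓝 (radialProj a 0 w)) := by
  have hpos := (regLength_pos (ε := 0) (.inr (sub_ne_zero.2 hw))).ne'
  have h1 : Tendsto (fun n => regDirection (ε n) (w - a)) atTop (𝓝 (regDirection 0 (w - a))) := by
    have h2 : Tendsto (fun n => regLength (ε n) (w - a)) atTop (𝓝 (regLength 0 (w - a))) :=
      ((continuous_regLength.comp (continuous_id.prodMk continuous_const)).tendsto 0).comp hε
    exact (h2.inv₀ hpos).smul_const _
  have h3 : Continuous fun y : V => a + rayLength a y • y := by unfold rayLength; fun_prop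
  exact (h3.tendsto _).comp h1

lemma tendsto_radialProjDeriv {a w : V} (ha : ‖a‖ < 1) (hw : w ≠ a) {ε : ℕ → ℝ}
    (hε : Tendsto ε atTop (𝓝 0)) (v : V) :
    Tendsto (fun n => radialProjDeriv a (ε n) w v) atTop (𝓝 (radialProjDeriv a 0 w v)) := by
  have h1 : Tendsto (fun n => radialProjDeriv a (ε n) w) atTop (𝓝 (radialProjDeriv a 0 w)) :=
    Tendsto.comp (g := fun p : ℝ × V => radialProjDeriv a p.1 p.2) (f := fun n => (ε n, w))
      (continuousAt_radialProjDeriv ha (ε := 0) (.inr hw))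
      (hε.prodMk_nhds (tendsto_const_nhds (x := w)))
  exact ((ContinuousLinearMap.apply ℝ V v).continuous.tendsto _).comp h1

lemma norm_radialProjDeriv_apply_le {a : V} (ha : ‖a‖ < 1) (ε : ℝ) {w : V} (hw : w ≠ a) (v : V) :
    ‖radialProjDeriv a ε w v‖ ≤ 10 * (‖w - a‖⁻¹ * ‖v‖) := by
  have h0 : 0 < ‖w - a‖ := norm_pos_iff.2 (sub_ne_zero.2 hw)
  refine ((radialProjDeriv a ε w).le_opNorm v).trans ?_
  rw [← mul_assoc]
  gcongr
  refine (norm_radialProjDeriv_le ha ε w).trans ?_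
  gcongr
  exact norm_le_regLength _ _

lemma continuous_radialProjDeriv {a : V} (ha : ‖a‖ < 1) {ε : ℝ} (hε : ε ≠ 0) :
    Continuous (radialProjDeriv a ε) :=
  continuous_iff_continuousAt.2 fun w => (continuousAt_radialProjDeriv ha (w := w) (.inl hε)).comp
    (f := fun w => ((ε, w) : ℝ × V)) (by fun_prop)

/-- The unregularized projection is an almost everywhere limit of C¹ ones, since w avoids the centre
almost everywhere. -/
lemma aestronglyMeasurable_radialProj {X : Type*} [MeasurableSpace X] {ν : Measure X}
    {w : X → V} (hw : AEStronglyMeasurable w ν) {a : V} (ha : ‖a‖ < 1)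
    (hne : ∀ᵐ x ∂ν, w x ≠ a) : AEStronglyMeasurable (fun x => radialProj a 0 (w x)) ν := by
  refine aestronglyMeasurable_of_tendsto_ae atTop
    (f := fun (n : ℕ) x => radialProj a (1 / ((n : ℝ) + 1)) (w x)) (fun n => ?_) ?_
  · exact (contDiff_radialProj ha (by positivity)).continuous.comp_aestronglyMeasurable hw
  · filter_upwards [hne] with x hx
    exact tendsto_radialProj hx tendsto_one_div_add_atTop_nhds_zero_nat

lemma aestronglyMeasurable_radialProjDeriv {X : Type*} [MeasurableSpace X] {ν : Measure X}
    {w g : X → V} (hw : AEStronglyMeasurable w ν) (hg : AEStronglyMeasurable g ν) {a : V}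
    (ha : ‖a‖ < 1) (hne : ∀ᵐ x ∂ν, w x ≠ a) :
    AEStronglyMeasurable (fun x => radialProjDeriv a 0 (w x) (g x)) ν := by
  refine aestronglyMeasurable_of_tendsto_ae atTop
    (f := fun (n : ℕ) x => radialProjDeriv a (1 / ((n : ℝ) + 1)) (w x) (g x)) (fun n => ?_) ?_
  · exact isBoundedBilinearMap_apply.continuous.comp_aestronglyMeasurable
      (((continuous_radialProjDeriv ha (by positivity)).comp_aestronglyMeasurable hw).prodMk hg)
  · filter_upwards [hne] with x hx
    exact tendsto_radialProjDeriv ha hx tendsto_one_div_add_atTop_nhds_zero_nat _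

/-- Chain rule for the radial projection, which is singular at its centre. -/
theorem HasWeakDerivAlong.radialProj [μ.IsAddHaarMeasure] {Ω : Set E} (hΩ : IsOpen Ω) {e : E}
    {w g : E → V} (hw : IntegrableOn w Ω μ) (hg : IntegrableOn g Ω μ)
    (h : HasWeakDerivAlong μ Ω e w g) {a : V} (ha : ‖a‖ < 1)
    (hne : ∀ᵐ x ∂μ.restrict Ω, w x ≠ a)
    (hint : IntegrableOn (fun x => ‖w x - a‖⁻¹ * ‖g x‖) Ω μ) :
    HasWeakDerivAlong μ Ω e (fun x => ReversePoincare.radialProj a 0 (w x))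
      (fun x => radialProjDeriv a 0 (w x) (g x)) := by
  intro ψ hψ hψc hψΩ
  set ε : ℕ → ℝ := fun n => 1 / ((n : ℝ) + 1) with hεdef
  have hε0 : ∀ n, 0 < ε n := fun n => by positivity
  have hε : Tendsto ε atTop (𝓝 0) := tendsto_one_div_add_atTop_nhds_zero_nat
  have hψ'c : Continuous fun x => fderiv ℝ ψ x e := by
    have := (hψ.of_le (by norm_cast) : ContDiff ℝ 1 ψ).continuous_fderiv one_ne_zero
    fun_prop
  have hψi : Integrable (fun x => fderiv ℝ ψ x e) μ :=
    hψ'c.integrable_of_hasCompactSupport (hψc.fderiv_apply ℝ e)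
  obtain ⟨A, hA⟩ := hψc.exists_bound_of_continuous hψ.continuous
  have hA0 : 0 ≤ A := (norm_nonneg _).trans (hA 0)
  have hd : ∀ n y, fderiv ℝ (ReversePoincare.radialProj a (ε n)) y = radialProjDeriv a (ε n) y :=
    fun n y => (hasFDerivAt_radialProj ha (.inl (hε0 n).ne')).fderiv
  have hid : ∀ n, ∫ x in Ω, fderiv ℝ ψ x e • ReversePoincare.radialProj a (ε n) (w x) ∂μ
      = - ∫ x in Ω, ψ x • radialProjDeriv a (ε n) (w x) (g x) ∂μ := fun n => by
    have := h.comp hΩ hw hg (contDiff_radialProj ha (hε0 n).ne')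
      (fun y => norm_radialProj_le ha (ε n) y) (C := 10 * (ε n)⁻¹) (fun y => by
        rw [hd]
        refine (norm_radialProjDeriv_le ha _ _).trans ?_
        have : ε n ≤ regLength (ε n) (y - a) :=
          Real.le_sqrt_of_sq_le (by nlinarith [sq_nonneg ‖y - a‖])
        gcongr) ψ hψ hψc hψΩ
    simpa only [hd] using this
  have hlimL : Tendsto (fun n => ∫ x in Ω, fderiv ℝ ψ x e • ReversePoincare.radialProj a (ε n) (w x)
      ∂μ) atTop (𝓝 (∫ x in Ω, fderiv ℝ ψ x e • ReversePoincare.radialProj a 0 (w x) ∂μ)) := by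
    refine tendsto_integral_of_dominated_convergence (fun x => ‖fderiv ℝ ψ x e‖ * 4)
      (fun n => ?_) (hψi.norm.mul_const 4).integrableOn (fun n => .of_forall fun x => ?_) ?_
    · exact hψ'c.aestronglyMeasurable.smul
        ((contDiff_radialProj ha (hε0 n).ne').continuous.comp_aestronglyMeasurable hw.1)
    · rw [norm_smul]; gcongr; exact norm_radialProj_le ha _ _
    · filter_upwards [hne] with x hx
      exact (tendsto_radialProj hx hε).const_smul _
  have hlimR : Tendsto (fun n => ∫ x in Ω, ψ x • radialProjDeriv a (ε n) (w x) (g x) ∂μ) atTop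
      (𝓝 (∫ x in Ω, ψ x • radialProjDeriv a 0 (w x) (g x) ∂μ)) := by
    refine tendsto_integral_of_dominated_convergence
      -- This majorant does not involve n; its integrability is the hypothesis `hint`, secured later
      -- by the choice of the centre.
      (fun x => A * (10 * (‖w x - a‖⁻¹ * ‖g x‖)))
      (fun n => ?_) ((hint.const_mul 10).const_mul A) (fun n => ?_) ?_
    · exact hψ.continuous.aestronglyMeasurable.smul
        (isBoundedBilinearMap_apply.continuous.comp_aestronglyMeasurable
          (((continuous_radialProjDeriv ha (hε0 n).ne').comp_aestronglyMeasurable hw.1).prodMk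
            hg.1))
    · filter_upwards [hne] with x hx
      rw [norm_smul]
      exact mul_le_mul (hA x) (norm_radialProjDeriv_apply_le ha _ hx _) (norm_nonneg _) hA0
    · filter_upwards [hne] with x hx
      exact (tendsto_radialProjDeriv ha hx hε _).const_smul _
  exact tendsto_nhds_unique (hlimL.congr hid) hlimR.neg

end SingularChainRule

/-! ### Choice of the centre of projection by averaging -/

section Averaging

open Metric
open scoped ENNReal

/-- The exponent 2 is below the dimension 3. -/
lemma lintegral_ball_inv_sq_lt_top :
    ∫⁻ z in ball (0 : E3) 1, (‖z‖ₑ ^ 2)⁻¹ < ⊤ := by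
  have h : IntegrableOn (fun z : E3 => (‖z‖ ^ 2)⁻¹) (ball 0 1) := by
    refine integrableOn_ball_of_norm_le_rpow (C := 1) (α := 2) (by simp) (by simp; norm_num)
      (.of_forall fun z => le_of_eq ?_) (by fun_prop)
    rw [Real.norm_of_nonneg (by positivity), one_mul, Real.rpow_neg (norm_nonneg _)]
    norm_cast
  refine lt_of_eq_of_lt (lintegral_congr_ae ?_) h.2
  have h0 : ∀ᵐ z : E3 ∂volume.restrict (ball 0 1), z ≠ 0 :=
    ae_restrict_of_ae (Measure.ae_ne volume 0)
  filter_upwards [h0] with z hz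
  rw [enorm_inv (by simpa using hz), enorm_pow, enorm_norm]

/-- The average of `‖y - a‖⁻²` over the centres `a` is bounded uniformly in `y`. -/
lemma lintegral_ball_inv_sq_sub_le (y : E3) :
    ∫⁻ a in ball (0 : E3) (1 / 2), (‖y - a‖ₑ ^ 2)⁻¹
      ≤ (∫⁻ z in ball (0 : E3) 1, (‖z‖ₑ ^ 2)⁻¹) + volume (ball (0 : E3) (1 / 2)) := by
  set f : E3 → ℝ≥0∞ := (ball (0 : E3) 1).indicator fun z => (‖z‖ₑ ^ 2)⁻¹ with hf
  have hfm : Measurable f := Measurable.indicator (by fun_prop) measurableSet_ball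
  -- Near y the singular part is counted by f, and at distance at least 1 the integrand is at most
  -- 1; translation invariance then removes y.
  have hle : ∀ a, (‖y - a‖ₑ ^ 2)⁻¹ ≤ f (y - a) + 1 := fun a => by
    by_cases ha : y - a ∈ ball (0 : E3) 1
    · simp [hf, indicator_of_mem ha]
    · rw [hf, indicator_of_notMem ha, zero_add, ENNReal.inv_le_one]
      rw [mem_ball_zero_iff, not_lt] at ha
      exact one_le_pow₀ (by rw [← ofReal_norm]; exact ENNReal.one_le_ofReal.2 ha)
  calc ∫⁻ a in ball (0 : E3) (1 / 2), (‖y - a‖ₑ ^ 2)⁻¹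
      ≤ ∫⁻ a in ball (0 : E3) (1 / 2), (f (y - a) + 1) := lintegral_mono hle
    _ = (∫⁻ a in ball (0 : E3) (1 / 2), f (y - a)) + volume (ball (0 : E3) (1 / 2)) := by
        rw [lintegral_add_right _ measurable_const, setLIntegral_one]
    _ ≤ (∫⁻ a, f (y - a)) + volume (ball (0 : E3) (1 / 2)) := by
        gcongr; exact Measure.restrict_le_self
    _ = _ := by
        rw [lintegral_sub_left_eq_self f y, hf, lintegral_indicator measurableSet_ball]

/-- Choice of a good centre for the radial projection, by averaging. -/
theorem exists_center : ∃ C : NNReal, ∀ {X : Type} [MeasurableSpace X] (ν : Measure X)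
    [IsFiniteMeasure ν] (w : X → E3) (g : X → ℝ≥0∞), AEMeasurable w ν → AEMeasurable g ν →
    ∃ a : E3, ‖a‖ < 1 / 2 ∧ (∀ᵐ x ∂ν, w x ≠ a) ∧
      ∫⁻ x, g x * (‖w x - a‖ₑ ^ 2)⁻¹ ∂ν ≤ C * ∫⁻ x, g x ∂ν := by
  set b := ball (0 : E3) (1 / 2) with hb
  set J : ℝ≥0∞ := (∫⁻ z in ball (0 : E3) 1, (‖z‖ₑ ^ 2)⁻¹) + volume b with hJ
  have hJt : J ≠ ⊤ := (ENNReal.add_lt_top.2 ⟨lintegral_ball_inv_sq_lt_top, measure_ball_lt_top⟩).ne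
  have hb0 : volume b ≠ 0 := (measure_ball_pos _ _ (by norm_num)).ne'
  have hbt : volume b ≠ ⊤ := measure_ball_lt_top.ne
  have hCt : (volume b)⁻¹ * J ≠ ⊤ := ENNReal.mul_ne_top (ENNReal.inv_ne_top.2 hb0) hJt
  refine ⟨((volume b)⁻¹ * J).toNNReal, fun {X} _ ν _ w g hw hg => ?_⟩
  rw [ENNReal.coe_toNNReal hCt]
  have hsub : AEMeasurable (fun p : E3 × X => (‖w p.2 - p.1‖ₑ ^ 2)⁻¹)
      ((volume.restrict b).prod ν) := by
    have : AEMeasurable (fun p : E3 × X => w p.2 - p.1) ((volume.restrict b).prod ν) :=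
      (hw.comp_snd).sub measurable_fst.aemeasurable
    exact ((this.enorm).pow_const 2).inv
  have hswap : ∀ f : X → ℝ≥0∞, AEMeasurable f ν →
      ∫⁻ a in b, ∫⁻ x, f x * (‖w x - a‖ₑ ^ 2)⁻¹ ∂ν ≤ J * ∫⁻ x, f x ∂ν := fun f hf => by
    rw [lintegral_lintegral_swap ((hf.comp_snd).mul hsub), ← lintegral_const_mul'' _ hf]
    refine lintegral_mono fun x => ?_
    have hm : Measurable fun a : E3 => (‖w x - a‖ₑ ^ 2)⁻¹ := by fun_prop
    rw [lintegral_const_mul _ hm, mul_comm]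
    gcongr
    exact lintegral_ball_inv_sq_sub_le (w x)
  -- Averaging the weight 1 shows that the integral is finite for almost every a. As 0⁻¹ = ⊤ here,
  -- finiteness excludes w = a on a set of positive measure.
  have hne : ∀ᵐ a ∂volume.restrict b, ∀ᵐ x ∂ν, w x ≠ a := by
    have h1 := hswap (fun _ => 1) aemeasurable_const
    simp only [one_mul, lintegral_const] at h1
    have h2 : ∀ᵐ a ∂volume.restrict b, ∫⁻ x, (‖w x - a‖ₑ ^ 2)⁻¹ ∂ν < ⊤ :=
      ae_lt_top' hsub.lintegral_prod_right'
        (h1.trans_lt (ENNReal.mul_lt_top hJt.lt_top (measure_lt_top _ _))).ne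
    filter_upwards [h2] with a ha
    have hm : AEMeasurable (fun x => (‖w x - a‖ₑ ^ 2)⁻¹) ν :=
      (((hw.sub_const a).enorm).pow_const 2).inv
    filter_upwards [ae_lt_top' hm ha.ne] with x hx hxa
    simp [hxa] at hx
  have hmem : ∀ᵐ a ∂volume.restrict b, a ∈ b := ae_restrict_mem measurableSet_ball
  have hF : AEMeasurable (fun a => ∫⁻ x, g x * (‖w x - a‖ₑ ^ 2)⁻¹ ∂ν) (volume.restrict b) :=
    ((hg.comp_snd).mul hsub).lintegral_prod_right'
  have : IsFiniteMeasure (volume.restrict b) := isFiniteMeasure_restrict.2 hbt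
  obtain ⟨a, haN, ha⟩ := exists_notMem_null_le_laverage
    (by simpa [Measure.restrict_eq_zero] using hb0) hF (ae_iff.1 (hne.and hmem))
  have haN' : (∀ᵐ x ∂ν, w x ≠ a) ∧ a ∈ b := by simpa using haN
  refine ⟨a, by simpa [hb] using haN'.2, haN'.1, ha.trans ?_⟩
  rw [setLAverage_eq, ENNReal.div_eq_inv_mul, mul_assoc]
  gcongr
  exact hswap g hg

/-- Real-valued form of `exists_center`. Integrability is a separate conclusion, as a Bochner
integral bound alone would not give it. -/
theorem exists_center_integral : ∃ C : ℝ, 0 ≤ C ∧ ∀ {X : Type} [MeasurableSpace X] (ν : Measure X)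
    [IsFiniteMeasure ν] (w : X → E3) (g : X → ℝ), AEMeasurable w ν → Integrable g ν →
    (∀ x, 0 ≤ g x) → ∃ a : E3, ‖a‖ < 1 / 2 ∧ (∀ᵐ x ∂ν, w x ≠ a) ∧
      Integrable (fun x => g x * (‖w x - a‖⁻¹) ^ 2) ν ∧
      ∫ x, g x * (‖w x - a‖⁻¹) ^ 2 ∂ν ≤ C * ∫ x, g x ∂ν := by
  obtain ⟨C, hC⟩ := exists_center
  refine ⟨C, C.coe_nonneg, fun {X} _ ν _ w g hw hg hg0 => ?_⟩
  obtain ⟨a, ha, hne, hle⟩ := hC ν w (fun x => ENNReal.ofReal (g x)) hw hg.1.aemeasurable.ennreal_ofReal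
  have hnn : ∀ x, 0 ≤ g x * (‖w x - a‖⁻¹) ^ 2 := fun x => mul_nonneg (hg0 x) (by positivity)
  have hm : AEStronglyMeasurable (fun x => g x * (‖w x - a‖⁻¹) ^ 2) ν :=
    (hg.1.aemeasurable.mul ((hw.sub_const a).norm.inv.pow_const 2)).aestronglyMeasurable
  have heq : ∫⁻ x, ENNReal.ofReal (g x * (‖w x - a‖⁻¹) ^ 2) ∂ν
      = ∫⁻ x, ENNReal.ofReal (g x) * (‖w x - a‖ₑ ^ 2)⁻¹ ∂ν := by
    refine lintegral_congr_ae ?_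
    filter_upwards [hne] with x hx
    have hpos : 0 < ‖w x - a‖ := norm_pos_iff.2 (sub_ne_zero.2 hx)
    rw [ENNReal.ofReal_mul (hg0 x), inv_pow, ENNReal.ofReal_inv_of_pos (by positivity),
      ENNReal.ofReal_pow hpos.le, ofReal_norm]
  have hgi := ofReal_integral_eq_lintegral_ofReal hg (.of_forall hg0)
  have hfin : ∫⁻ x, ENNReal.ofReal (g x * (‖w x - a‖⁻¹) ^ 2) ∂ν
      ≤ ENNReal.ofReal (C * ∫ x, g x ∂ν) := by
    rw [heq, ENNReal.ofReal_mul C.coe_nonneg, hgi, ENNReal.ofReal_coe_nnreal]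
    exact hle
  refine ⟨a, ha, hne, ⟨hm, ?_⟩, ?_⟩
  · rw [hasFiniteIntegral_iff_ofReal (.of_forall hnn)]
    exact hfin.trans_lt ENNReal.ofReal_lt_top
  · rw [integral_eq_lintegral_of_nonneg_ae (.of_forall hnn) hm]
    exact ENNReal.toReal_le_of_le_ofReal (mul_nonneg C.coe_nonneg (integral_nonneg hg0)) hfin

end Averaging
end ReversePoincare

namespace ReversePoincare

/-! ### Cutoff functions between concentric balls -/

section Cutoff

open Metric Filter
open scoped Topology RealInnerProductSpace

lemma exists_abs_deriv_smoothTransition_le :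
    ∃ B : ℝ, 0 < B ∧ ∀ t, |deriv Real.smoothTransition t| ≤ B := by
  have hc : Continuous (deriv Real.smoothTransition) :=
    (Real.smoothTransition.contDiff (n := 1)).continuous_deriv le_rfl
  obtain ⟨B, hB⟩ := (isCompact_Icc (a := (0 : ℝ)) (b := 1)).exists_bound_of_continuousOn
    hc.continuousOn
  refine ⟨max B 1, by positivity, fun t => ?_⟩
  by_cases ht : t ∈ Icc (0 : ℝ) 1
  · exact (hB t ht).trans (le_max_left _ _)
  · have hz : deriv Real.smoothTransition t = 0 := by
      rcases lt_or_ge t 0 with h | h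
      · have : Real.smoothTransition =ᶠ[𝓝 t] fun _ => 0 := by
          filter_upwards [gt_mem_nhds h] with s hs
          exact Real.smoothTransition.zero_of_nonpos hs.le
        rw [this.deriv_eq, deriv_const]
      · have h1 : 1 < t := by
          by_contra h1
          exact ht ⟨h, not_lt.1 h1⟩
        have : Real.smoothTransition =ᶠ[𝓝 t] fun _ => 1 := by
          filter_upwards [lt_mem_nhds h1] with s hs
          exact Real.smoothTransition.one_of_one_le hs.le
        rw [this.deriv_eq, deriv_const]
    rw [hz, abs_zero]
    positivity

/-- Smooth cutoff functions between concentric balls, with the natural gradient bound. -/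
theorem exists_cutoff {V : Type*} [NormedAddCommGroup V] [InnerProductSpace ℝ V] :
    ∃ c : ℝ, 0 < c ∧ ∀ (x₀ : V) (ρ R : ℝ), 0 < ρ → ρ < R →
      ∃ θ : V → ℝ, ContDiff ℝ ∞ θ ∧ (∀ x, θ x ∈ Icc (0 : ℝ) 1) ∧ (∀ x ∈ ball x₀ ρ, θ x = 1) ∧
        (∀ x ∉ ball x₀ R, θ x = 0) ∧ ∀ x v, |fderiv ℝ θ x v| ≤ c / (R - ρ) * ‖v‖ := by
  obtain ⟨B, hB0, hB⟩ := exists_abs_deriv_smoothTransition_le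
  refine ⟨2 * B, by positivity, fun x₀ ρ R hρ hR => ?_⟩
  have hD : 0 < R ^ 2 - ρ ^ 2 := by nlinarith
  -- The squared norm keeps q smooth at x₀, and R² - ρ² = (R-ρ)(R+ρ) leaves the bound of order
  -- 1/(R-ρ).
  set q : V → ℝ := fun x => (R ^ 2 - ‖x - x₀‖ ^ 2) / (R ^ 2 - ρ ^ 2) with hq
  have hqs : ContDiff ℝ ∞ q :=
    (contDiff_const.sub ((contDiff_id.sub contDiff_const).norm_sq ℝ)).div_const _
  have hq0 : ∀ x, R ≤ ‖x - x₀‖ → q x ≤ 0 := fun x hx =>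
    div_nonpos_of_nonpos_of_nonneg (by nlinarith) hD.le
  refine ⟨fun x => Real.smoothTransition (q x), Real.smoothTransition.contDiff.comp hqs,
    fun x => ⟨Real.smoothTransition.nonneg _, Real.smoothTransition.le_one _⟩, fun x hx => ?_,
    fun x hx => ?_, fun x v => ?_⟩
  · refine Real.smoothTransition.one_of_one_le ((one_le_div hD).2 ?_)
    rw [mem_ball, dist_eq_norm] at hx
    nlinarith [norm_nonneg (x - x₀)]
  · rw [mem_ball, dist_eq_norm, not_lt] at hx
    exact Real.smoothTransition.zero_of_nonpos (hq0 x hx)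
  · have hqd : HasFDerivAt q
        ((R ^ 2 - ρ ^ 2)⁻¹ • (-(2 • innerSL ℝ (x - x₀)) : V →L[ℝ] ℝ)) x := by
      have h1 : HasFDerivAt (fun x : V => ‖x - x₀‖ ^ 2) (2 • innerSL ℝ (x - x₀)) x := by
        have := (hasStrictFDerivAt_norm_sq (x - x₀)).hasFDerivAt.comp x
          ((hasFDerivAt_id x).sub_const x₀)
        rwa [ContinuousLinearMap.comp_id] at this
      simp only [hq, div_eq_mul_inv]
      exact (h1.const_sub _).mul_const _
    have hsd : HasDerivAt Real.smoothTransition (deriv Real.smoothTransition (q x)) (q x) :=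
      ((Real.smoothTransition.contDiff (n := 1)).differentiable one_ne_zero _).hasDerivAt
    rw [show fderiv ℝ (fun x => Real.smoothTransition (q x)) x = _ from
      (hsd.comp_hasFDerivAt x hqd).fderiv]
    have hRρ : 0 < R - ρ := sub_pos.2 hR
    rcases le_or_gt ‖x - x₀‖ R with hx | hx
    · have hin := abs_real_inner_le_norm (x - x₀) v
      simp only [smul_apply, neg_apply, innerSL_apply_apply, smul_eq_mul, nsmul_eq_mul, abs_mul,
        abs_neg, abs_inv, abs_of_pos hD]
      rw [show |((2 : ℕ) : ℝ)| = 2 by norm_num]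
      calc _ ≤ B * ((R ^ 2 - ρ ^ 2)⁻¹ * (2 * (‖x - x₀‖ * ‖v‖))) := by gcongr; exact hB _
        _ ≤ B * ((R ^ 2 - ρ ^ 2)⁻¹ * (2 * ((R + ρ) * ‖v‖))) := by gcongr; linarith
        _ = _ := by
          have : R ^ 2 - ρ ^ 2 = (R - ρ) * (R + ρ) := by ring
          have : R + ρ ≠ 0 := by linarith
          rw [‹R ^ 2 - ρ ^ 2 = _›]
          field_simp
    · have hz : deriv Real.smoothTransition (q x) = 0 := by
        have hlt : q x < 0 := div_neg_of_neg_of_pos (by nlinarith) hD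
        have : Real.smoothTransition =ᶠ[𝓝 (q x)] fun _ => 0 := by
          filter_upwards [gt_mem_nhds hlt] with s hs
          exact Real.smoothTransition.zero_of_nonpos hs.le
        rw [this.deriv_eq, deriv_const]
      rw [hz]
      simp only [zero_smul, zero_apply, abs_zero]
      positivity

end Cutoff

/-! ### The iteration lemma -/

section Iteration

open Filter
open scoped Topology

/-- The iteration lemma behind hole filling. -/
theorem exists_iteration_const {θ : ℝ} (hθ0 : 0 ≤ θ) (hθ1 : θ < 1) :
    ∃ C : ℝ, 0 < C ∧ ∀ (f : ℝ → ℝ) (S A B s₀ r : ℝ), 0 ≤ A → 0 ≤ B → s₀ < r → 0 ≤ S →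
      (∀ s, s₀ ≤ s → s < r → f s ≤ S) →
      (∀ s t, s₀ ≤ s → s < t → t < r → f s ≤ θ * f t + A / (t - s) ^ 2 + B) →
      f s₀ ≤ C * (A / (r - s₀) ^ 2 + B) := by
  -- Any l < 1 with l² > θ would do; here l² - θ = (1-θ)²/4.
  set l : ℝ := (1 + θ) / 2 with hl
  have hl0 : 0 < l := by rw [hl]; linarith
  have hl1 : 0 < 1 - l := by rw [hl]; linarith
  set q : ℝ := θ / l ^ 2 with hqdef
  have hq0 : 0 ≤ q := by positivity
  have hq1 : q < 1 := by rw [hqdef, div_lt_one (by positivity)]; nlinarith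
  have hq1' : 0 < 1 - q := sub_pos.2 hq1
  refine ⟨((1 - q) * (1 - l) ^ 2)⁻¹, by positivity,
    fun f S A B s₀ r hA hB hsr hS hbd hstep => ?_⟩
  set D : ℝ := A / (1 - l) ^ 2 + B * (r - s₀) ^ 2 with hD
  -- The weight (r-s)² compensates the factor (t-s)⁻²: with r-t = l(r-s), one step contracts the
  -- weighted function by q = θ/l² and adds D. The a priori bound S only enters through a term
  -- killed by qⁿ.
  have key : ∀ n : ℕ, ∀ s, s₀ ≤ s → s < r →
      (r - s) ^ 2 * f s ≤ q ^ n * (S * (r - s₀) ^ 2) + D / (1 - q) := by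
    intro n
    induction n with
    | zero =>
      intro s hs hsr'
      have h1 : (r - s) ^ 2 ≤ (r - s₀) ^ 2 := pow_le_pow_left₀ (by linarith) (by linarith) 2
      have h2 : (r - s) ^ 2 * f s ≤ (r - s₀) ^ 2 * S :=
        (mul_le_mul_of_nonneg_left (hbd s hs hsr') (sq_nonneg _)).trans
          (mul_le_mul_of_nonneg_right h1 hS)
      have h3 : 0 ≤ D / (1 - q) := by positivity
      rw [pow_zero, one_mul]
      linarith
    | succ n ih =>
      intro s hs hsr'
      have hrs : 0 < r - s := sub_pos.2 hsr'
      set t := s + (1 - l) * (r - s) with ht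
      have hst : s < t := by rw [ht]; nlinarith
      have hrt : r - t = l * (r - s) := by rw [ht]; ring
      have htr : t < r := by
        have : 0 < r - t := by rw [hrt]; positivity
        linarith
      have h1 := hstep s t hs hst htr
      have h2 := ih t (hs.trans hst.le) htr
      have hts : t - s = (1 - l) * (r - s) := by rw [ht]; ring
      have h3 : (r - s) ^ 2 * f s ≤ q * ((r - t) ^ 2 * f t) + D := by
        have h4 := mul_le_mul_of_nonneg_left h1 (sq_nonneg (r - s))
        have h5 : (r - s) ^ 2 * (θ * f t + A / (t - s) ^ 2 + B)
            = q * ((r - t) ^ 2 * f t) + A / (1 - l) ^ 2 + B * (r - s) ^ 2 := by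
          rw [hts, hrt, hqdef]
          field_simp
        have h6 : (r - s) ^ 2 ≤ (r - s₀) ^ 2 := pow_le_pow_left₀ hrs.le (by linarith) 2
        have h7 := mul_le_mul_of_nonneg_left h6 hB
        rw [h5] at h4
        rw [hD]
        linarith
      have h8 := mul_le_mul_of_nonneg_left h2 hq0
      have h9 : q * (q ^ n * (S * (r - s₀) ^ 2) + D / (1 - q)) + D
          = q ^ (n + 1) * (S * (r - s₀) ^ 2) + D / (1 - q) := by
        field_simp
        ring
      linarith
  have hlim : Tendsto (fun n : ℕ => q ^ n * (S * (r - s₀) ^ 2) + D / (1 - q)) atTop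
      (𝓝 (0 * (S * (r - s₀) ^ 2) + D / (1 - q))) :=
    ((tendsto_pow_atTop_nhds_zero_of_lt_one hq0 hq1).mul_const _).add_const _
  have hfin := ge_of_tendsto' hlim fun n => key n s₀ le_rfl hsr
  rw [zero_mul, zero_add] at hfin
  have hrs : 0 < r - s₀ := sub_pos.2 hsr
  have h1 : f s₀ ≤ D / (1 - q) / (r - s₀) ^ 2 := by
    rw [le_div_iff₀ (by positivity), mul_comm]; exact hfin
  refine h1.trans ?_
  have h2 : D / (1 - q) / (r - s₀) ^ 2
      = ((1 - q) * (1 - l) ^ 2)⁻¹ * (A / (r - s₀) ^ 2 + B * (1 - l) ^ 2) := by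
    rw [hD]
    field_simp
  rw [h2]
  gcongr
  refine mul_le_of_le_one_right hB (pow_le_one₀ hl1.le (by linarith))

end Iteration

end ReversePoincare

namespace ReversePoincare

/-! ### Columns and the Frobenius norm -/

section Matrix

/-- The `j`-th column of a matrix, as a vector of Euclidean space. -/
noncomputable def col (B : Mat3) (j : Fin 3) : E3 := WithLp.toLp 2 fun i => B i j

@[simp] lemma col_apply (B : Mat3) (i j : Fin 3) : col B j i = B i j := rfl

lemma normSq_nonneg (B : Mat3) : 0 ≤ normSq B := by
  unfold normSq; positivity

lemma normSq_eq_sum_norm_col (B : Mat3) : normSq B = ∑ j, ‖col B j‖ ^ 2 := by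
  rw [normSq, Finset.sum_comm]
  refine Finset.sum_congr rfl fun j _ => ?_
  rw [EuclideanSpace.norm_sq_eq]
  simp

lemma abs_apply_le_matNorm (B : Mat3) (i j : Fin 3) : |B i j| ≤ matNorm B := by
  refine Real.abs_le_sqrt ?_
  refine (Finset.single_le_sum (f := fun j => B i j ^ 2) (fun j _ => sq_nonneg _)
    (Finset.mem_univ j)).trans ?_
  exact Finset.single_le_sum (f := fun i => ∑ j, B i j ^ 2)
    (fun i _ => Finset.sum_nonneg fun j _ => sq_nonneg _) (Finset.mem_univ i)

/-- The energy density depends on A only through A Aᵀ, to which ellipticity and the Lipschitz bound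
apply. -/
lemma normSq_mul_eq (B A : Mat3) :
    normSq (B * A) = ∑ i, ((A * A.transpose).mulVec (B i)) ⬝ᵥ (B i) := by
  simp only [normSq, Matrix.mul_apply, Matrix.mulVec, dotProduct, Matrix.transpose_apply,
    Fin.sum_univ_three]
  ring

lemma normSq_eq_sum_dotProduct (B : Mat3) : normSq B = ∑ i, B i ⬝ᵥ B i := by
  simp only [normSq, dotProduct, sq]

end Matrix

/-! ### Energy bounds and the two forms of the weak gradient -/

section Energy

variable {Ω : Set E3} {A : E3 → Mat3} {u : E3 → E3} {Du : E3 → Mat3} {L M N β η : ℝ} {K : ℝ → ℝ}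

lemma A1.le_normSq_mul (h : A1 Ω A u Du L M N β η K) {x : E3} (hx : x ∈ Ω) (B : Mat3) :
    normSq B ≤ β * normSq (B * A x) := by
  have hβ := h.β_pos
  rw [normSq_mul_eq, normSq_eq_sum_dotProduct, Finset.mul_sum]
  refine Finset.sum_le_sum fun i _ => ?_
  have := mul_le_mul_of_nonneg_left (h.elliptic x hx (B i)).1 hβ.le
  rwa [← mul_assoc, mul_one_div_cancel hβ.ne', one_mul] at this

lemma A1.normSq_mul_le (h : A1 Ω A u Du L M N β η K) {x : E3} (hx : x ∈ Ω) (B : Mat3) :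
    normSq (B * A x) ≤ β * normSq B := by
  rw [normSq_mul_eq, normSq_eq_sum_dotProduct, Finset.mul_sum]
  exact Finset.sum_le_sum fun i _ => (h.elliptic x hx (B i)).2

lemma A1.continuousOn_mul_transpose (h : A1 Ω A u Du L M N β η K) (i j : Fin 3) :
    ContinuousOn (fun x => (A x * (A x).transpose) i j) Ω := by
  have hlip : LipschitzOnWith (Real.toNNReal L) (fun x => (A x * (A x).transpose) i j) Ω := by
    refine LipschitzOnWith.of_dist_le_mul fun x hx y hy => ?_
    rw [Real.coe_toNNReal _ h.L_pos.le, Real.dist_eq]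
    exact (abs_apply_le_matNorm (A x * (A x).transpose - A y * (A y).transpose) i j).trans
      (h.lipschitz x hx y hy)
  exact hlip.continuousOn

lemma integrable_normSq {μ : Measure E3} {D : E3 → Mat3}
    (hD : ∀ i j, MemLp (fun x => D x i j) 2 μ) : Integrable (fun x => normSq (D x)) μ :=
  integrable_finsetSum _ fun i _ => integrable_finsetSum _ fun j _ => (hD i j).integrable_sq

/-- A itself need not be measurable. Measurability of the density comes from the continuity of A Aᵀ,
the bound from ellipticity. -/
lemma A1.integrableOn_normSq_mul (h : A1 Ω A u Du L M N β η K) {v : E3 → E3} {Dv : E3 → Mat3}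
    (hv : IsH1Sphere Ω v Dv) : IntegrableOn (fun x => normSq (Dv x * A x)) Ω := by
  refine ((integrable_normSq hv.grad_memLp).const_mul β).mono' ?_ ?_
  · simp only [normSq_mul_eq, Matrix.mulVec, dotProduct]
    have hA : ∀ i j, AEStronglyMeasurable (fun x => (A x * (A x).transpose) i j)
        (volume.restrict Ω) := fun i j =>
      (h.continuousOn_mul_transpose i j).aestronglyMeasurable h.isOpen.measurableSet
    refine Finset.aestronglyMeasurable_fun_sum _ fun i _ =>
      Finset.aestronglyMeasurable_fun_sum _ fun j _ => ?_
    exact (Finset.aestronglyMeasurable_fun_sum _ fun k _ =>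
      (hA j k).mul (hv.grad_memLp i k).1).mul (hv.grad_memLp i j).1
  · filter_upwards [ae_restrict_mem h.isOpen.measurableSet] with x hx
    rw [Real.norm_of_nonneg (normSq_nonneg _)]
    exact h.normSq_mul_le hx _

lemma memLp_col {μ : Measure E3} {D : E3 → Mat3} (hD : ∀ i j, MemLp (fun x => D x i j) 2 μ)
    (j : Fin 3) : MemLp (fun x => col (D x) j) 2 μ := by
  have : (fun x => col (D x) j) = fun x => ∑ i, D x i j • EuclideanSpace.single i (1 : ℝ) := by
    funext x
    ext k
    simp [Finset.sum_apply, Pi.single_apply]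
  rw [this]
  refine memLp_finsetSum _ fun i _ => ?_
  exact (ContinuousLinearMap.toSpanSingleton ℝ
    (EuclideanSpace.single i (1 : ℝ) : E3)).comp_memLp' (hD i j)

lemma integral_apply {X : Type*} [MeasurableSpace X] {μ : Measure X} {f : X → E3}
    (hf : Integrable f μ) (i : Fin 3) : (∫ x, f x ∂μ) i = ∫ x, f x i ∂μ :=
  ((EuclideanSpace.proj i : E3 →L[ℝ] ℝ).integral_comp_comm hf).symm

lemma integrableOn_smul_of_hasCompactSupport {a : E3 → ℝ} {f : E3 → E3} (ha : Continuous a)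
    (hac : HasCompactSupport a) (hf : IntegrableOn f Ω) :
    IntegrableOn (fun x => a x • f x) Ω := by
  obtain ⟨B, hB⟩ := hac.exists_bound_of_continuous ha
  exact hf.bdd_smul B ha.aestronglyMeasurable (.of_forall hB)

/-- A weak gradient is the same as a system of weak directional derivatives. -/
theorem hasWeakGradient_iff {D : E3 → Mat3} (hu : IntegrableOn u Ω)
    (hD : ∀ j, IntegrableOn (fun x => col (D x) j) Ω) :
    HasWeakGradient Ω u D ↔ ∀ j, HasWeakDerivAlong volume Ω (EuclideanSpace.single j 1) u
      fun x => col (D x) j := by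
  have key : ∀ φ : E3 → ℝ, ContDiff ℝ ∞ φ → HasCompactSupport φ → ∀ j : Fin 3,
      (∫ x in Ω, fderiv ℝ φ x (EuclideanSpace.single j 1) • u x
        = - ∫ x in Ω, φ x • col (D x) j) ↔
      ∀ i, ∫ x in Ω, u x i * fderiv ℝ φ x (EuclideanSpace.single j 1)
        = - ∫ x in Ω, D x i j * φ x := by
    intro φ hφ hφc j
    have hφ' : Continuous fun x => fderiv ℝ φ x (EuclideanSpace.single j 1) := by
      have := (hφ.of_le (by norm_cast) : ContDiff ℝ 1 φ).continuous_fderiv one_ne_zero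
      fun_prop
    have h1 := integrableOn_smul_of_hasCompactSupport hφ' (hφc.fderiv_apply ℝ _) hu
    have h2 := integrableOn_smul_of_hasCompactSupport hφ.continuous hφc (hD j)
    have h3 : ∀ i, (∫ x in Ω, fderiv ℝ φ x (EuclideanSpace.single j 1) • u x) i
        = ∫ x in Ω, u x i * fderiv ℝ φ x (EuclideanSpace.single j 1) := fun i => by
      rw [integral_apply h1]
      simp [mul_comm]
    have h4 : ∀ i, (- ∫ x in Ω, φ x • col (D x) j) i = - ∫ x in Ω, D x i j * φ x := fun i => by
      rw [PiLp.neg_apply, integral_apply h2]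
      simp [mul_comm]
    refine ⟨fun h i => by rw [← h3, h, h4], fun h => ?_⟩
    ext i
    rw [h3, h4, h i]
  exact ⟨fun h j φ hφ hφc hφΩ => (key φ hφ hφc j).2 fun i => h φ hφ hφc hφΩ i j,
    fun h φ hφ hφc hφΩ i j => (key φ hφ hφc j).1 (h j φ hφ hφc hφΩ) i⟩

end Energy
end ReversePoincare

namespace ReversePoincare

/-! ### The comparison map -/

section Competitor

open Metric Filter
open scoped Topology

variable {Ω : Set E3}

/-- Interpolation in an annulus between a map and a constant. -/
theorem exists_interpolation : ∃ c : ℝ, 0 < c ∧ ∀ {Ω : Set E3}, IsOpen Ω →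
    Bornology.IsBounded Ω → ∀ (u : E3 → E3) (D : Fin 3 → E3 → E3),
    MemLp u 2 (volume.restrict Ω) → (∀ j, MemLp (D j) 2 (volume.restrict Ω)) →
    (∀ j, HasWeakDerivAlong volume Ω (EuclideanSpace.single j 1) u (D j)) →
    ∀ (x₀ ξ : E3) (ρ R : ℝ), 0 < ρ → ρ < R →
    ∃ (w : E3 → E3) (g : Fin 3 → E3 → E3), MemLp w 2 (volume.restrict Ω) ∧
      (∀ j, MemLp (g j) 2 (volume.restrict Ω)) ∧
      (∀ j, HasWeakDerivAlong volume Ω (EuclideanSpace.single j 1) w (g j)) ∧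
      (∀ x ∉ ball x₀ R, w x = u x) ∧
      ∀ j x, ‖g j x‖ ^ 2 ≤ (ball x₀ ρ)ᶜ.indicator (fun x => 2 * ‖D j x‖ ^ 2) x
        + 2 * (c / (R - ρ)) ^ 2 * ‖u x - ξ‖ ^ 2 := by
  obtain ⟨c, hc, hcut⟩ := exists_cutoff (V := E3)
  refine ⟨c, hc, fun {Ω} hΩ hΩb u D hu hD hwd x₀ ξ ρ R hρ hR => ?_⟩
  obtain ⟨θ, hθ, hθI, hθ1, hθ0, hθd⟩ := hcut x₀ ρ R hρ hR
  have hfin : IsFiniteMeasure (volume.restrict Ω) :=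
    isFiniteMeasure_restrict.2 hΩb.measure_lt_top.ne
  have hRρ : 0 < R - ρ := sub_pos.2 hR
  set κ := c / (R - ρ) with hκ
  set e : Fin 3 → E3 := fun j => EuclideanSpace.single j 1 with he
  have hui : IntegrableOn u Ω := hu.integrable one_le_two
  have hDi : ∀ j, IntegrableOn (D j) Ω := fun j => (hD j).integrable one_le_two
  have hθ' : ContDiff ℝ ∞ fun x => 1 - θ x := contDiff_const.sub hθ
  have hd' : ∀ x v, fderiv ℝ (fun x => 1 - θ x) x v = - fderiv ℝ θ x v := fun x v => by
    rw [fderiv_const_sub]; rfl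
  have hθc : Continuous θ := hθ.continuous
  have hdc : ∀ v, Continuous fun x => fderiv ℝ θ x v := fun v => by
    have := (hθ.of_le (by norm_cast) : ContDiff ℝ 1 θ).continuous_fderiv one_ne_zero
    fun_prop
  have hconst : MemLp (fun _ : E3 => ξ) 2 (volume.restrict Ω) := memLp_const ξ
  set w : E3 → E3 := fun x => (1 - θ x) • u x + θ x • ξ with hw
  set g : Fin 3 → E3 → E3 := fun j x =>
    ((1 - θ x) • D j x + fderiv ℝ (fun x => 1 - θ x) x (e j) • u x)
      + (θ x • (0 : E3) + fderiv ℝ θ x (e j) • ξ) with hg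
  have hbdd : ∀ (a : E3 → ℝ) (C : ℝ) (f : E3 → E3), Continuous a → (∀ x, |a x| ≤ C) →
      MemLp f 2 (volume.restrict Ω) → MemLp (fun x => a x • f x) 2 (volume.restrict Ω) :=
    fun a C f ha hC hf => hf.of_le_mul (c := C) (ha.aestronglyMeasurable.smul hf.1)
      (.of_forall fun x => by
        rw [norm_smul]; gcongr; exact hC x)
  have hejn : ∀ j, ‖e j‖ = 1 := fun j => by simp [he]
  have hdb : ∀ j x, |fderiv ℝ θ x (e j)| ≤ κ := fun j x => by
    simpa [hejn] using hθd x (e j)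
  have habs : ∀ x, |1 - θ x| ≤ 1 := fun x => by
    rw [abs_le]; constructor <;> linarith [(hθI x).1, (hθI x).2]
  have habs' : ∀ x, |θ x| ≤ 1 := fun x => by
    rw [abs_le]; constructor <;> linarith [(hθI x).1, (hθI x).2]
  have m1 : MemLp (fun x => (1 - θ x) • u x) 2 (volume.restrict Ω) :=
    hbdd _ 1 _ hθ'.continuous habs hu
  have m2 : MemLp (fun x => θ x • ξ) 2 (volume.restrict Ω) := hbdd _ 1 _ hθc habs' hconst
  have m3 : ∀ j, MemLp (fun x => (1 - θ x) • D j x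
      + fderiv ℝ (fun x => 1 - θ x) x (e j) • u x) 2 (volume.restrict Ω) := fun j => by
    refine (hbdd _ 1 _ hθ'.continuous habs (hD j)).add ?_
    simp only [hd']
    exact hbdd _ κ _ (hdc _).neg (fun x => by rw [abs_neg]; exact hdb j x) hu
  have m4 : ∀ j, MemLp (fun x => θ x • (0 : E3) + fderiv ℝ θ x (e j) • ξ) 2
      (volume.restrict Ω) := fun j => by
    simp only [smul_zero, zero_add]
    exact hbdd _ κ _ (hdc _) (hdb j) hconst
  refine ⟨w, g, m1.add m2, fun j => (m3 j).add (m4 j), fun j => ?_, fun x hx => ?_, fun j x => ?_⟩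
  · refine HasWeakDerivAlong.add (m1.integrable one_le_two) ((m3 j).integrable one_le_two)
      (m2.integrable one_le_two) ((m4 j).integrable one_le_two)
      ((hwd j).smul hui (hDi j) hθ')
      ((hasWeakDerivAlong_const hΩ.measurableSet (e j) ξ).smul (hconst.integrable one_le_two)
        (integrable_zero _ _ _) hθ)
  · simp [hw, hθ0 x hx]
  · have hgx : g j x = (1 - θ x) • D j x - fderiv ℝ θ x (e j) • (u x - ξ) := by
      simp only [hg, hd', smul_zero, zero_add, smul_sub, neg_smul]
      abel
    -- In the inner ball w is the constant ξ: this is the hole, where the gradient of u does not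
    -- contribute.
    by_cases hx : x ∈ ball x₀ ρ
    · have h1 : θ =ᶠ[𝓝 x] fun _ => 1 := by
        filter_upwards [isOpen_ball.mem_nhds hx] with y hy using hθ1 y hy
      rw [hgx, h1.fderiv_eq, hθ1 x hx]
      simp only [sub_self, zero_smul, fderiv_fun_const, Pi.zero_apply, zero_apply, norm_zero]
      rw [indicator_of_notMem (by simpa using hx), zero_pow two_ne_zero]
      positivity
    · rw [indicator_of_mem hx]
      have h1 : ‖g j x‖ ≤ ‖D j x‖ + κ * ‖u x - ξ‖ := by
        rw [hgx]
        refine (norm_sub_le _ _).trans ?_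
        rw [norm_smul, norm_smul]
        gcongr
        · exact mul_le_of_le_one_left (norm_nonneg _) (habs x)
        · exact hdb j x
      have h2 := pow_le_pow_left₀ (norm_nonneg _) h1 2
      nlinarith [sq_nonneg (‖D j x‖ - κ * ‖u x - ξ‖)]

/-- Projection of a Sobolev map onto the sphere, with control of the energy. -/
theorem exists_projection : ∃ C : ℝ, 0 < C ∧ ∀ {Ω : Set E3}, IsOpen Ω →
    Bornology.IsBounded Ω → ∀ (w : E3 → E3) (g : Fin 3 → E3 → E3),
    MemLp w 2 (volume.restrict Ω) → (∀ j, MemLp (g j) 2 (volume.restrict Ω)) →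
    (∀ j, HasWeakDerivAlong volume Ω (EuclideanSpace.single j 1) w (g j)) →
    ∀ U : Set E3, MeasurableSet U → U ⊆ Ω →
    (∀ᵐ x ∂volume.restrict Ω, x ∉ U → ‖w x‖ = 1) →
    ∃ (v : E3 → E3) (Dv : E3 → Mat3), IsH1Sphere Ω v Dv ∧ (∀ x, ‖w x‖ = 1 → v x = w x) ∧
      ∫ x in U, normSq (Dv x) ≤ C * ∫ x in U, ∑ j, ‖g j x‖ ^ 2 := by
  obtain ⟨C, hC, hcent⟩ := exists_center_integral
  -- 100 is the square of the factor 10 in the derivative bound; adding 1 keeps the constant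
  -- positive.
  refine ⟨100 * C + 1, by positivity, fun {Ω} hΩ hΩb w g hw hg hwd U hU hUΩ hw1 => ?_⟩
  have hfin : IsFiniteMeasure (volume.restrict Ω) :=
    isFiniteMeasure_restrict.2 hΩb.measure_lt_top.ne
  set S : E3 → ℝ := fun x => ∑ j, ‖g j x‖ ^ 2 with hS
  have hS0 : ∀ x, 0 ≤ S x := fun x => by positivity
  have hSi : Integrable S (volume.restrict Ω) :=
    integrable_finsetSum _ fun j _ => (hg j).integrable_norm_pow two_ne_zero
  -- The centre is adapted to the energy in U alone, so that the final bound involves no energy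
  -- outside U.
  obtain ⟨a, ha, hne, hai, hale⟩ := hcent (volume.restrict Ω) w (U.indicator S)
    hw.1.aemeasurable (hSi.indicator hU) (fun x => indicator_nonneg (fun x _ => hS0 x) x)
  have ha1 : ‖a‖ < 1 := by linarith
  -- Outside U, |w| = 1 and |a| < 1/2 keep w at distance at least 1/2 from a; so the projected
  -- gradient is square integrable on all of Ω.
  have hbound : ∀ᵐ x ∂volume.restrict Ω, S x * (‖w x - a‖⁻¹) ^ 2
      ≤ U.indicator S x * (‖w x - a‖⁻¹) ^ 2 + 4 * S x := by
    filter_upwards [hw1] with x hx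
    by_cases hxU : x ∈ U
    · rw [indicator_of_mem hxU]
      linarith [hS0 x]
    · rw [indicator_of_notMem hxU, zero_mul, zero_add, mul_comm]
      have h1 : (1 / 2 : ℝ) ≤ ‖w x - a‖ := by
        have := norm_sub_norm_le (w x) a
        rw [hx hxU] at this
        linarith
      have h2 : ‖w x - a‖⁻¹ ≤ 2 := by
        rw [inv_le_comm₀ (by linarith) two_pos]; linarith
      have h3 : (‖w x - a‖⁻¹) ^ 2 ≤ 2 ^ 2 := pow_le_pow_left₀ (by positivity) h2 2
      have := hS0 x
      nlinarith
  have hSw : Integrable (fun x => S x * (‖w x - a‖⁻¹) ^ 2) (volume.restrict Ω) := by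
    refine (hai.add (hSi.const_mul 4)).mono' ?_ ?_
    · exact (hSi.1.aemeasurable.mul
        (((hw.1.aemeasurable.sub_const a).norm.inv).pow_const 2)).aestronglyMeasurable
    · filter_upwards [hbound] with x hx
      rw [Real.norm_of_nonneg (mul_nonneg (hS0 x) (by positivity))]
      exact hx
  have hH : ∀ j, MemLp (fun x => ‖w x - a‖⁻¹ * ‖g j x‖) 2 (volume.restrict Ω) := fun j => by
    have hm : AEStronglyMeasurable (fun x => ‖w x - a‖⁻¹ * ‖g j x‖) (volume.restrict Ω) :=
      (((hw.1.aemeasurable.sub_const a).norm.inv).mul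
        (hg j).1.aemeasurable.norm).aestronglyMeasurable
    refine (memLp_two_iff_integrable_sq hm).2 (hSw.mono' (hm.pow 2) (.of_forall fun x => ?_))
    rw [Real.norm_of_nonneg (by positivity), mul_pow, mul_comm]
    gcongr
    exact Finset.single_le_sum (f := fun j => ‖g j x‖ ^ 2) (fun j _ => by positivity)
      (Finset.mem_univ j)
  set v : E3 → E3 := fun x => radialProj a 0 (w x) with hv
  set G : Fin 3 → E3 → E3 := fun j x => radialProjDeriv a 0 (w x) (g j x) with hG
  set Dv : E3 → Mat3 := fun x i j => G j x i with hDv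
  have hcol : ∀ j, (fun x => col (Dv x) j) = G j := fun j => rfl
  have hGle : ∀ᵐ x ∂volume.restrict Ω, ∀ j, ‖G j x‖ ≤ 10 * (‖w x - a‖⁻¹ * ‖g j x‖) := by
    filter_upwards [hne] with x hx j
    exact norm_radialProjDeriv_apply_le ha1 0 hx _
  have hGm : ∀ j, MemLp (G j) 2 (volume.restrict Ω) := fun j => by
    refine (hH j).of_le_mul (c := 10)
      (aestronglyMeasurable_radialProjDeriv hw.1 (hg j).1 ha1 hne) ?_
    filter_upwards [hGle] with x hx
    rw [Real.norm_of_nonneg (by positivity)]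
    exact hx j
  have hvm : MemLp v 2 (volume.restrict Ω) :=
    MemLp.of_bound (aestronglyMeasurable_radialProj hw.1 ha1 hne) 4
      (.of_forall fun x => norm_radialProj_le ha1 0 (w x))
  refine ⟨v, Dv, ⟨hvm, fun i j => ?_, ?_, ?_⟩, fun x hx => ?_, ?_⟩
  · exact (EuclideanSpace.proj i : E3 →L[ℝ] ℝ).comp_memLp' (hGm j)
  · refine (hasWeakGradient_iff (hvm.integrable one_le_two)
      fun j => (hGm j).integrable one_le_two).2 fun j => ?_
    exact (hwd j).radialProj hΩ (hw.integrable one_le_two) ((hg j).integrable one_le_two) ha1 hne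
      ((hH j).integrable one_le_two)
  · filter_upwards [hne] with x hx
    exact norm_radialProj_zero ha1 hx
  · exact radialProj_zero_of_norm_eq_one ha1 hx
  · have hres : volume.restrict U = (volume.restrict Ω).restrict U := by
      rw [Measure.restrict_restrict hU, inter_eq_left.2 hUΩ]
    have hle : ∀ᵐ x ∂volume.restrict U, normSq (Dv x) ≤ 100 * (S x * (‖w x - a‖⁻¹) ^ 2) := by
      rw [hres]
      filter_upwards [ae_restrict_of_ae hGle] with x hx
      rw [normSq_eq_sum_norm_col, hS]
      simp only [Finset.sum_mul, Finset.mul_sum]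
      refine Finset.sum_le_sum fun j _ => ?_
      refine (pow_le_pow_left₀ (norm_nonneg _) (hx j) 2).trans (le_of_eq ?_)
      ring
    have hind : ∀ f : E3 → ℝ, ∫ x in Ω, U.indicator f x = ∫ x in U, f x := fun f => by
      rw [integral_indicator hU, ← hres]
    have hind' : ∫ x in Ω, U.indicator S x * (‖w x - a‖⁻¹) ^ 2
        = ∫ x in U, S x * (‖w x - a‖⁻¹) ^ 2 := by
      rw [← hind]
      congr 1 with x
      by_cases hx : x ∈ U <;> simp [hx]
    rw [hind, hind'] at hale
    have hSU : 0 ≤ ∫ x in U, S x := integral_nonneg hS0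
    calc ∫ x in U, normSq (Dv x) ≤ ∫ x in U, 100 * (S x * (‖w x - a‖⁻¹) ^ 2) :=
          integral_mono_of_nonneg (.of_forall fun x => normSq_nonneg _)
            ((hSw.mono_measure (Measure.restrict_mono hUΩ le_rfl)).const_mul 100) hle
      _ = 100 * ∫ x in U, S x * (‖w x - a‖⁻¹) ^ 2 := integral_const_mul _ _
      _ ≤ (100 * C + 1) * ∫ x in U, S x := by linarith

/-- The comparison map. -/
theorem exists_competitor : ∃ C : ℝ, 0 < C ∧ ∀ {Ω : Set E3}, IsOpen Ω →
    Bornology.IsBounded Ω → ∀ (u : E3 → E3) (Du : E3 → Mat3), IsH1Sphere Ω u Du →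
    ∀ (x₀ ξ : E3) (ρ R : ℝ), 0 < ρ → ρ < R → ball x₀ R ⊆ Ω →
    ∃ (v : E3 → E3) (Dv : E3 → Mat3), IsH1Sphere Ω v Dv ∧
      (∀ᵐ x ∂volume.restrict (Ω \ ball x₀ R), v x = u x) ∧
      ∫ x in ball x₀ R, normSq (Dv x) ≤ C * ((∫ x in ball x₀ R, normSq (Du x))
        - (∫ x in ball x₀ ρ, normSq (Du x))
        + (∫ x in ball x₀ R, ‖u x - ξ‖ ^ 2) / (R - ρ) ^ 2) := by
  obtain ⟨c, hc, hint⟩ := exists_interpolation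
  obtain ⟨C, hC, hproj⟩ := exists_projection
  -- 2 comes from (a+b)² ≤ 2a² + 2b², and 6 from summing the second term over the three columns.
  refine ⟨C * (2 + 6 * c ^ 2), by positivity,
    fun {Ω} hΩ hΩb u Du hu x₀ ξ ρ R hρ hR hball => ?_⟩
  have hfin : IsFiniteMeasure (volume.restrict Ω) :=
    isFiniteMeasure_restrict.2 hΩb.measure_lt_top.ne
  have hcol := memLp_col hu.grad_memLp
  have hwd := (hasWeakGradient_iff (hu.memLp.integrable one_le_two)
    fun j => (hcol j).integrable one_le_two).1 hu.hasWeakGradient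
  obtain ⟨w, g, hw, hg, hgd, hwu, hgle⟩ :=
    hint hΩ hΩb u (fun j x => col (Du x) j) hu.memLp hcol hwd x₀ ξ ρ R hρ hR
  have hw1 : ∀ᵐ x ∂volume.restrict Ω, x ∉ ball x₀ R → ‖w x‖ = 1 := by
    filter_upwards [hu.mem_sphere] with x hx hxR
    rw [hwu x hxR, hx]
  obtain ⟨v, Dv, hv, hvw, hle⟩ :=
    hproj hΩ hΩb w g hw hg hgd (ball x₀ R) measurableSet_ball hball hw1
  refine ⟨v, Dv, hv, ?_, hle.trans ?_⟩
  · have h1 : ∀ᵐ x ∂volume.restrict (Ω \ ball x₀ R), ‖u x‖ = 1 :=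
      ae_mono (Measure.restrict_mono sdiff_subset le_rfl) hu.mem_sphere
    filter_upwards [h1, ae_restrict_mem (hΩ.measurableSet.diff measurableSet_ball)] with x hx hxm
    have := hwu x hxm.2
    rw [hvw x (by rw [this, hx]), this]
  · have hDi : IntegrableOn (fun x => normSq (Du x)) (ball x₀ R) :=
      (integrable_normSq hu.grad_memLp).mono_measure (Measure.restrict_mono hball le_rfl)
    have hui : IntegrableOn (fun x => ‖u x - ξ‖ ^ 2) (ball x₀ R) :=
      ((hu.memLp.sub (memLp_const ξ)).integrable_norm_pow two_ne_zero).mono_measure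
        (Measure.restrict_mono hball le_rfl)
    have hsub : ball x₀ ρ ⊆ ball x₀ R := ball_subset_ball hR.le
    have hsum : ∀ x, ∑ j, ‖g j x‖ ^ 2 ≤ 2 * (ball x₀ ρ)ᶜ.indicator (fun x => normSq (Du x)) x
        + 6 * (c / (R - ρ)) ^ 2 * ‖u x - ξ‖ ^ 2 := fun x => by
      refine (Finset.sum_le_sum fun j _ => hgle j x).trans (le_of_eq ?_)
      rw [Finset.sum_add_distrib, Finset.sum_const, Finset.card_univ, Fintype.card_fin]
      by_cases hx : x ∈ (ball x₀ ρ)ᶜ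
      · simp only [indicator_of_mem hx, normSq_eq_sum_norm_col, Finset.mul_sum, nsmul_eq_mul]
        push_cast
        ring
      · simp only [indicator_of_notMem hx, nsmul_eq_mul]
        push_cast
        simp
        ring
    have hdiff : ∫ x in ball x₀ R, (ball x₀ ρ)ᶜ.indicator (fun x => normSq (Du x)) x
        = (∫ x in ball x₀ R, normSq (Du x)) - ∫ x in ball x₀ ρ, normSq (Du x) := by
      rw [setIntegral_indicator measurableSet_ball.compl, ← sdiff_eq,
        setIntegral_sdiff measurableSet_ball hDi hsub]
    have hind : IntegrableOn ((ball x₀ ρ)ᶜ.indicator fun x => normSq (Du x)) (ball x₀ R) :=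
      hDi.indicator measurableSet_ball.compl
    have hmain : ∫ x in ball x₀ R, ∑ j, ‖g j x‖ ^ 2
        ≤ 2 * ((∫ x in ball x₀ R, normSq (Du x)) - ∫ x in ball x₀ ρ, normSq (Du x))
          + 6 * (c / (R - ρ)) ^ 2 * ∫ x in ball x₀ R, ‖u x - ξ‖ ^ 2 := by
      rw [← hdiff, ← integral_const_mul, ← integral_const_mul,
        ← integral_add (hind.const_mul 2) (hui.const_mul _)]
      exact integral_mono_of_nonneg (.of_forall fun x => by positivity)
        ((hind.const_mul 2).add (hui.const_mul _)) (.of_forall hsum)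
    have hX : 0 ≤ (∫ x in ball x₀ R, normSq (Du x)) - ∫ x in ball x₀ ρ, normSq (Du x) :=
      sub_nonneg.2 (setIntegral_mono_set hDi (.of_forall fun x => normSq_nonneg _)
        hsub.eventuallyLE)
    have hY : 0 ≤ (∫ x in ball x₀ R, ‖u x - ξ‖ ^ 2) / (R - ρ) ^ 2 :=
      div_nonneg (integral_nonneg fun x => by positivity) (sq_nonneg _)
    rw [mul_assoc]
    refine mul_le_mul_of_nonneg_left (hmain.trans ?_) hC.le
    have : 6 * (c / (R - ρ)) ^ 2 * ∫ x in ball x₀ R, ‖u x - ξ‖ ^ 2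
        = 6 * c ^ 2 * ((∫ x in ball x₀ R, ‖u x - ξ‖ ^ 2) / (R - ρ) ^ 2) := by
      rw [div_pow]; ring
    rw [this]
    nlinarith [mul_nonneg (sq_nonneg c) hX]

end Competitor
end ReversePoincare

namespace ReversePoincare

/-! ### Hole filling and the reverse Poincaré inequality -/

section Main

open Metric Filter
open scoped Topology

/-- The hole-filling inequality. -/
theorem exists_hole_filling {β : ℝ} (hβ : 0 < β) : ∃ P : ℝ, 0 < P ∧
    ∀ {Ω : Set E3} {A : E3 → Mat3} {u : E3 → E3} {Du : E3 → Mat3} {L M N η : ℝ} {K : ℝ → ℝ},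
    A1 Ω A u Du L M N β η K → ∀ {α : ℝ}, α ∈ Ioo (0 : ℝ) 1 →
    ∀ (x₀ ξ : E3) (ρ R : ℝ), 0 < ρ → ρ < R → closedBall x₀ R ⊆ Ω →
    ∫ x in ball x₀ R, normSq (Du x) ≤ P * ((∫ x in ball x₀ R, normSq (Du x))
        - (∫ x in ball x₀ ρ, normSq (Du x))
        + (∫ x in ball x₀ R, ‖u x - ξ‖ ^ 2) / (R - ρ) ^ 2)
      + β * (K α * η ^ 2 * (2 * R) ^ (1 + 2 * α)) := by
  obtain ⟨C, hC, hcomp⟩ := exists_competitor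
  -- One β passes from |∇u|² to |∇u A|², the other from |∇v A|² to |∇v|².
  refine ⟨β * (β * C), by positivity, fun {Ω A u Du L M N η K} h {α} hα x₀ ξ ρ R hρ hR hcl => ?_⟩
  have hball : ball x₀ R ⊆ Ω := ball_subset_closedBall.trans hcl
  obtain ⟨v, Dv, hv, hvu, hle⟩ := hcomp h.isOpen h.isBounded u Du h.isH1Sphere x₀ ξ ρ R hρ hR hball
  have hmin := h.almost_minimizer α hα (ball x₀ R) isOpen_ball
    (closure_ball_subset_closedBall.trans hcl) v Dv hv hvu
  have hres : volume.restrict (ball x₀ R) ≤ volume.restrict Ω :=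
    Measure.restrict_mono hball le_rfl
  have hmem : ∀ᵐ x ∂volume.restrict (ball x₀ R), x ∈ Ω := by
    filter_upwards [ae_restrict_mem measurableSet_ball] with x hx using hball hx
  have h1 : ∫ x in ball x₀ R, normSq (Du x) ≤ β * ∫ x in ball x₀ R, normSq (Du x * A x) := by
    rw [← integral_const_mul]
    refine integral_mono_of_nonneg (.of_forall fun x => normSq_nonneg _)
      (((h.integrableOn_normSq_mul h.isH1Sphere).mono_set hball).const_mul β) ?_
    filter_upwards [hmem] with x hx using h.le_normSq_mul hx _
  have h2 : ∫ x in ball x₀ R, normSq (Dv x * A x) ≤ β * ∫ x in ball x₀ R, normSq (Dv x) := by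
    rw [← integral_const_mul]
    refine integral_mono_of_nonneg (.of_forall fun x => normSq_nonneg _)
      (((integrable_normSq hv.grad_memLp).mono_measure hres).const_mul β) ?_
    filter_upwards [hmem] with x hx using h.normSq_mul_le hx _
  have h3 : diam (ball x₀ R) ^ (1 + 2 * α) ≤ (2 * R) ^ (1 + 2 * α) :=
    Real.rpow_le_rpow diam_nonneg (diam_ball (hρ.trans hR).le) (by linarith [hα.1])
  have h4 : K α * η ^ 2 * diam (ball x₀ R) ^ (1 + 2 * α)
      ≤ K α * η ^ 2 * (2 * R) ^ (1 + 2 * α) :=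
    mul_le_mul_of_nonneg_left h3 (mul_nonneg (h.K_pos α hα).le (sq_nonneg _))
  have h5 := mul_le_mul_of_nonneg_left (hmin.trans (add_le_add (h2.trans
    (mul_le_mul_of_nonneg_left hle hβ.le)) h4)) hβ.le
  refine h1.trans (h5.trans (le_of_eq ?_))
  ring

/-- The reverse Poincaré inequality on every ball contained in the domain. -/
theorem exists_reversePoincareOn_const {β k c₀ α : ℝ} (hβ : 0 < β) (hk : 0 < k)
    (hc₀ : c₀ ∈ Ioo (0 : ℝ) 1) (hα : α ∈ Ioo (0 : ℝ) 1) : ∃ C : ℝ, 0 < C ∧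
    ∀ {Ω : Set E3} {A : E3 → Mat3} {u : E3 → E3} {Du : E3 → Mat3} {L M N η : ℝ} {K : ℝ → ℝ},
    K α = k → A1 Ω A u Du L M N β η K → ∀ (x₀ : E3) (r : ℝ), 0 < r → ball x₀ r ⊆ Ω →
    ReversePoincareOn u Du c₀ η α C x₀ r := by
  obtain ⟨P, hP, hfill⟩ := exists_hole_filling hβ
  have hθ1 : P / (1 + P) < 1 := by rw [div_lt_one (by positivity)]; linarith
  obtain ⟨C, hC, hiter⟩ := exists_iteration_const (by positivity : 0 ≤ P / (1 + P)) hθ1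
  set T : ℝ := 2 ^ (1 + 2 * α) with hT
  have hT0 : 0 < T := by positivity
  -- 4 arises from r - c₀r/2 ≥ r/2, and T from the diameter bound 2r.
  refine ⟨C * (4 * P + β * k * T), by positivity,
    fun {Ω A u Du L M N η K} hK h x₀ r hr hball => ?_⟩
  -- The mean over the largest ball serves all radii, so Q bounds every ∫_{B_t} |u-ξ|².
  set ξ : E3 := ⨍ w in ball x₀ r, u w with hξ
  set Q : ℝ := ∫ z in ball x₀ r, ‖u z - ξ‖ ^ 2 with hQ
  have hres : volume.restrict (ball x₀ r) ≤ volume.restrict Ω :=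
    Measure.restrict_mono hball le_rfl
  have hfin : IsFiniteMeasure (volume.restrict Ω) :=
    isFiniteMeasure_restrict.2 h.isBounded.measure_lt_top.ne
  have hui : IntegrableOn (fun x => ‖u x - ξ‖ ^ 2) (ball x₀ r) :=
    ((h.isH1Sphere.memLp.sub (memLp_const ξ)).integrable_norm_pow two_ne_zero).mono_measure hres
  have hDi : IntegrableOn (fun x => normSq (Du x)) (ball x₀ r) :=
    (integrable_normSq h.isH1Sphere.grad_memLp).mono_measure hres
  have hQ0 : 0 ≤ Q := integral_nonneg fun x => by positivity
  set f : ℝ → ℝ := fun s => ∫ x in ball x₀ s, normSq (Du x) with hf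
  have hmono : ∀ s t, s ≤ t → t ≤ r → f s ≤ f t := fun s t hst htr =>
    setIntegral_mono_set (hDi.mono_set (ball_subset_ball htr))
      (.of_forall fun x => normSq_nonneg _) (ball_subset_ball hst).eventuallyLE
  have hs₀ : 0 < c₀ * r / 2 := by have := hc₀.1; positivity
  have hs₀r : c₀ * r / 2 ≤ r / 2 := by
    have := mul_le_mul_of_nonneg_right hc₀.2.le hr.le
    linarith
  set Z : ℝ := β * (k * η ^ 2 * (2 * r) ^ (1 + 2 * α)) with hZ
  have hZ0 : 0 ≤ Z := by positivity
  have hmain := hiter f (f r) (P * Q) Z (c₀ * r / 2) r (by positivity) hZ0 (by linarith)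
    (integral_nonneg fun x => normSq_nonneg _) (fun s _ hsr => hmono s r hsr.le le_rfl) ?_
  · have hd : P * Q / (r - c₀ * r / 2) ^ 2 ≤ 4 * P * (Q / r ^ 2) := by
      have h1 : (r / 2) ^ 2 ≤ (r - c₀ * r / 2) ^ 2 :=
        pow_le_pow_left₀ (by linarith) (by linarith) 2
      calc P * Q / (r - c₀ * r / 2) ^ 2 ≤ P * Q / (r / 2) ^ 2 := by gcongr
        _ = 4 * P * (Q / r ^ 2) := by field_simp; ring
    have hpow : (2 * r) ^ (1 + 2 * α) = T * (r * r ^ (2 * α)) := by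
      rw [Real.mul_rpow two_pos.le hr.le, Real.rpow_add hr, Real.rpow_one]
    have hw0 : 0 ≤ η ^ 2 * r ^ (2 * α) := by positivity
    have hq0 : 0 ≤ Q / r ^ 3 := by positivity
    have hfinal : 1 / r * f (c₀ * r / 2)
        ≤ C * (4 * P * (Q / r ^ 3) + β * k * T * (η ^ 2 * r ^ (2 * α))) := by
      calc 1 / r * f (c₀ * r / 2) ≤ 1 / r * (C * (4 * P * (Q / r ^ 2) + Z)) := by
            gcongr
            exact hmain.trans (by gcongr)
        _ = _ := by
            rw [hZ, hpow]
            field_simp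
    change 1 / r * f (c₀ * r / 2) ≤ C * (4 * P + β * k * T) * (1 / r ^ 3 * Q + η ^ 2 * r ^ (2 * α))
    rw [one_div_mul_eq_div (r ^ 3)]
    refine hfinal.trans ?_
    rw [mul_assoc C]
    refine mul_le_mul_of_nonneg_left ?_ hC.le
    have hb : 0 ≤ β * k * T := by positivity
    nlinarith [mul_nonneg hP.le hw0, mul_nonneg hb hq0]
  · intro s t hs hst htr
    -- The strict inequality t < r puts the closed ball of radius t inside Ω, as almost-minimality
    -- demands.
    have h1 := hfill h hα x₀ ξ s t (hs₀.trans_le hs) hst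
      ((closedBall_subset_ball htr).trans hball)
    have h2 : ∫ x in ball x₀ t, ‖u x - ξ‖ ^ 2 ≤ Q :=
      setIntegral_mono_set hui (.of_forall fun x => by positivity)
        (ball_subset_ball htr.le).eventuallyLE
    have h3 : (∫ x in ball x₀ t, ‖u x - ξ‖ ^ 2) / (t - s) ^ 2 ≤ Q / (t - s) ^ 2 := by gcongr
    have h4 : β * (K α * η ^ 2 * (2 * t) ^ (1 + 2 * α)) ≤ Z := by
      rw [hK, hZ]
      have : 0 < t := (hs₀.trans_le hs).trans hst
      have := hα.1
      gcongr
    have h5 : f s ≤ f t := hmono s t hst.le htr.le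
    have h6 : f t ≤ P * (f t - f s + Q / (t - s) ^ 2) + Z :=
      h1.trans (add_le_add (mul_le_mul_of_nonneg_left (by gcongr) hP.le) h4)
    -- The hole is filled: P f(s) moves to the left, and the remaining f(t) there is bounded below
    -- by f(s).
    have h7 : (1 + P) * f s ≤ P * f t + P * Q / (t - s) ^ 2 + Z := by
      rw [mul_div_assoc]
      linarith
    have hX : 0 ≤ P * Q / (t - s) ^ 2 := by positivity
    have h8 : f s ≤ (P * f t + P * Q / (t - s) ^ 2 + Z) / (1 + P) := by
      rw [le_div_iff₀ (by positivity), mul_comm]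
      exact h7
    refine h8.trans ?_
    rw [add_div, add_div, mul_div_right_comm]
    have h1P : 1 ≤ 1 + P := by linarith
    exact add_le_add (add_le_add le_rfl (div_le_self hX h1P)) (div_le_self hZ0 h1P)

end Main
end ReversePoincare

theorem mainTheorem4 (L M N β d : ℝ) (K : ℝ → ℝ) (c₀ : ℝ) (hc₀ : c₀ ∈ Set.Ioo (0 : ℝ) 1)
    (α : ℝ) (hα : α ∈ Set.Ioo (0 : ℝ) 1) (Λ : ℝ) (hΛ : 0 < Λ) :
    (∃ C : ℝ, 0 < C ∧
      ∀ (Ω : Set ReversePoincare.E3) (A : ReversePoincare.E3 → ReversePoincare.Mat3)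
        (u : ReversePoincare.E3 → ReversePoincare.E3)
        (Du : ReversePoincare.E3 → ReversePoincare.Mat3) (η : ℝ),
        Metric.diam Ω ≤ d → ReversePoincare.A1 Ω A u Du L M N β η K →
        ∀ (x₀ : ReversePoincare.E3) (r : ℝ), 0 < r → Metric.ball x₀ (2 * r) ⊆ Ω →
          1 / r * ∫ x in Metric.ball x₀ (2 * r), ReversePoincare.normSq (Du x * A x) ≤ Λ →
          ReversePoincare.ReversePoincareOn u Du c₀ η α C x₀ r) ∧
    (∃ C : ℝ, 0 < C ∧
      ∀ (Ω : Set ReversePoincare.E3) (A : ReversePoincare.E3 → ReversePoincare.Mat3)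
        (u : ReversePoincare.E3 → ReversePoincare.E3)
        (Du : ReversePoincare.E3 → ReversePoincare.Mat3) (η : ℝ),
        Metric.diam Ω ≤ d → ReversePoincare.A1 Ω A u Du L M N β η K →
        ∀ (x₀ : ReversePoincare.E3) (r : ℝ), 0 < r → Metric.ball x₀ (3 * r) ⊆ Ω →
          1 / r * ∫ x in Metric.ball x₀ (3 * r), ReversePoincare.normSq (Du x * A x) ≤ Λ →
          ∀ y ∈ Metric.ball x₀ r, ∀ s : ℝ, 0 < s → s ≤ c₀ * r →
            ReversePoincare.ReversePoincareOn u Du c₀ η α C y s) := by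
  -- Positivity of β and K α belongs to `A1`, not to the data fixed before the constant. If it
  -- fails, no configuration satisfies `A1` and the constant 1 works vacuously.
  by_cases hpos : 0 < β ∧ 0 < K α
  · obtain ⟨C, hC, h⟩ :=
      ReversePoincare.exists_reversePoincareOn_const hpos.1 hpos.2 hc₀ hα
    refine ⟨⟨C, hC, fun Ω A u Du η _ hA x₀ r hr hball _ => ?_⟩,
      ⟨C, hC, fun Ω A u Du η _ hA x₀ r hr hball _ y hy s hs hsr => ?_⟩⟩
    · exact h rfl hA x₀ r hr ((Metric.ball_subset_ball (by linarith)).trans hball)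
    · refine h rfl hA y s hs ((Metric.ball_subset_ball' ?_).trans hball)
      have h1 : c₀ * r ≤ r := mul_le_of_le_one_left hr.le hc₀.2.le
      have h2 := Metric.mem_ball.1 hy
      linarith
  · exact ⟨⟨1, one_pos, fun Ω A u Du η _ hA => absurd ⟨hA.β_pos, hA.K_pos α hα⟩ hpos⟩,
      ⟨1, one_pos, fun Ω A u Du η _ hA => absurd ⟨hA.β_pos, hA.K_pos α hα⟩ hpos⟩⟩
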